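/- **Setting.** Let $X$, $Y$ be random vectors in $\mathbb R^{n_X}$, $\mathbb R^{n_Y}$ on a probability space, $B\subset\mathbb R^{n_\beta}$, $f:\mathbb R^{n_X}\times\mathbb R^{n_Y}\times\mathbb R^{n_\beta}\to\mathbb R^{n_f}$, $g:\mathbb R^{n_f}\to\mathbb R$ and $\Psi:\mathbb R^{n_X}\times\mathbb R^{n_\theta}\to\mathbb R^{n_f}$, with $f(\cdot,\cdot,\beta)$ and $\Psi(\cdot,\theta)$ Borel measurable. All norms are Euclidean (spectral for matrices). Write $F(X,\beta)=\mathbb E[f(X,Y,\beta)\mid X]$, $G(\beta)=\mathbb E[g(F(X,\beta))]$, $Q(\beta,\theta)=\tfrac12\mathbb E\|F(X,\beta)-\Psi(X,\theta)\|^2$, $$\Delta^\lambda(\beta,\theta)=\mathbb E\Big[g(F)-g(\Psi)-\langle\nabla g(\Psi),F-\Psi\rangle+\tfrac{\lambda}{2}\|F-\Psi\|^2\Big],\qquad w=G+\alpha\Delta^\lambda,$$ where $F=F(X,\beta)$ and $\Psi=\Psi(X,\theta)$. A function $h:\mathbb R^n\to\mathbb R$ is *differentiable in the generalized sense* with generalized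 subdifferential $\hat\partial h:\mathbb R^n\rightrightarrows\mathbb R^n$ if $\hat\partial h$ is upper semicontinuous with nonempty convex compact values and, for every $x$, $\sup_{s\in\hat\partial h(y)}|h(y)-h(x)-\langle s,y-x\rangle|=o(\|y-x\|)$ as $y\to x$. A vector function is differentiable in the generalized sense if its components are; its generalized subdifferential is an upper semicontinuous multifunction with nonempty convex compact values, consisting of Jacobians ($n\times m$ matrices for maps $\mathbb R^n\to\mathbb R^m$), whose $j$-th columns form a generalized subdifferential of the $j$-th component, for every $j$. **Assumptions.** - (A1) $B$ is convex and compact. - (A2) $g$ is continuously differentiable, $\nabla g$ is bounded, differentiable in the generalized sense, and Lipschitz with constant $L_{\nabla g}$. - (A3) For all $x,y$, $f(x,y,\cdot)$ is differentiable in the generalized sense with generalized subdifferential $\hat\partial f(x,y,\cdot)$; for some function $L_f(x,y)$ and constants $\bar L_f,C_f>0$, for all $\beta\in B$ and all $x,y$: $\|s\|\le L_f(x,y)$ for $s\in\hat\partial f(x,y,\beta)$, $\mathbb E[L_f(X,Y)^4]\le\bar L_f^4$ and $\mathbb E\|f(X,Y,\beta)\|^4\le C_f^4$. - (A4) For all $x$,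 $\Psi(x,\cdot)$ is differentiable in the generalized sense with generalized subdifferential $\hat\partial\Psi(x,\cdot)$; for some function $L_\Psi(x)$ and constants $\bar L_\Psi,C_\Psi>0$: $\|s\|\le L_\Psi(x)$ for all $x$, $\theta$ and $s\in\hat\partial\Psi(x,\theta)$, $\mathbb E[L_\Psi(X)^4]\le\bar L_\Psi^4$, and $\mathbb E\|\Psi(X,\theta^0)\|^4\le C_\Psi^4$ for some $\theta^0$. - (A5) There is $M>0$ with $Q(\beta,\theta)\le M\,\mathrm{dist}(0,\hat\partial_\theta Q(\beta,\theta))^2$ for all $\beta\in B$, $\theta\in\mathbb R^{n_\theta}$. - (A6) There is $\underline R>0$ with $\langle\theta,q\rangle>0$ for all $\beta\in B$, $\|\theta\|\ge\underline R$ and $q\in\hat\partial_\theta Q(\beta,\theta)$. Here expectations (and conditional expectations) of set-valued maps are the sets of (conditional) expectations of all measurable selections, $\hat\partial_\beta F(X,\beta)=\mathbb E[\hat\partial f(X,Y,\beta)\mid X]$, $\hat\partial G(\beta)=\mathbb E[\hat\partial_\beta F(X,\beta)\nabla g(F(X,\beta))]$ and $\hat\partial_\theta Q(\beta,\theta)=-\mathbb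 E[\hat\partial\Psi(X,\theta)(F(X,\beta)-\Psi(X,\theta))]$. **Differential inclusion.** Let $R\ge\underline R$, $\mathbb Z=B\times\{\theta:\|\theta\|\le R\}$, $\gamma>0$, and $$\Gamma(\beta,\theta)=\mathbb E\begin{bmatrix}-\hat\partial_\beta F(X,\beta)\,\nabla g(\Psi(X,\theta))\\ \gamma\,\hat\partial\Psi(X,\theta)\,(F(X,\beta)-\Psi(X,\theta))\end{bmatrix}.$$ A solution is an absolutely continuous $Z=(\beta,\theta)$ on $[0,\infty)$ with $\dot Z(t)\in\Gamma(Z(t))-\mathcal N_{\mathbb Z}(Z(t))$ for almost every $t\ge0$, where $\mathcal N_K(x)$ denotes the normal cone to the convex set $K$ at $x$, empty if $x\notin K$. Let $B^*=\{\beta\in B:0\in\hat\partial G(\beta)+\mathcal N_B(\beta)\}$ and $\mathbb Z^*=\{(\beta,\theta):\beta\in B^*,\ Q(\beta,\theta)=0\}$. **Theorem.** Assume (A1)–(A6), $\alpha>0$, $\lambda\ge0$, $\gamma>0$, and $$\lambda>2\bar L_\Psi^2ML_{\nabla g}\quad\text{and}\quad\gamma>\frac{\bar L_f^2M\big((\alpha+1)L_{\nabla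 g}+\alpha\lambda\big)^2}{2\alpha\big(\lambda-2\bar L_\Psi^2ML_{\nabla g}\big)}.$$ Let $Z=(\beta,\theta)$ be any solution of the differential inclusion and $W(t)=w(\beta(t),\theta(t))$. Then $W$ is absolutely continuous on bounded intervals of $[0,\infty)$, and its (weak) derivative satisfies, for almost every $t\ge0$, $\dot W(t)\le0$, and $\dot W(t)<0$ if $(\beta(t),\theta(t))\notin\mathbb Z^*$. -/

import Mathlib

open MeasureTheory Set Filter Topology
open scoped InnerProductSpace Pointwise

namespace CondStochOpt

/-- `ℝⁿ` with the Euclidean norm. -/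
abbrev Vec (n : ℕ) := EuclideanSpace ℝ (Fin n)

/-- Generalized Jacobians of maps `ℝⁿ → ℝᵐ`, in the convention of `n × m` matrices (column `j`
is a generalized gradient of component `j`), with the spectral norm. -/
abbrev Jac (m n : ℕ) := Vec m →L[ℝ] Vec n

/-- The space of pairs `(β, θ)` with the Euclidean norm. -/
abbrev Pair (nβ nθ : ℕ) := WithLp 2 (Vec nβ × Vec nθ)

/-! ### Generalized (Norkin) differentiability -/

/-- `D` is a generalized subdifferential mapping of `h : ℝⁿ → ℝ` in the sense of Norkin:
it is nonempty-, convex- and compact-valued and upper semicontinuous, and for every `x`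
`h y = h x + ⟪s, y - x⟫ + o(x, y, s)` for all `s ∈ D y`, with
`sup_{s ∈ D y} |o(x, y, s)| / ‖y - x‖ → 0` as `y → x`. -/
structure IsGenSubdiff {n : ℕ} (h : Vec n → ℝ) (D : Vec n → Set (Vec n)) : Prop where
  nonempty : ∀ x, (D x).Nonempty
  convex : ∀ x, Convex ℝ (D x)
  compact : ∀ x, IsCompact (D x)
  usc : UpperHemicontinuous D
  expansion : ∀ x, ∀ ε > 0, ∀ᶠ y in 𝓝 x, ∀ s ∈ D y,
    |h y - h x - ⟪s, y - x⟫_ℝ| ≤ ε * ‖y - x‖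

/-- A vector function is differentiable in the generalized sense if all its components are. -/
def GenDifferentiable {n m : ℕ} (h : Vec n → Vec m) : Prop :=
  ∀ j, ∃ D, IsGenSubdiff (fun x => h x j) D

/-- `D` is a generalized subdifferential (set of generalized Jacobians) of `h : ℝⁿ → ℝᵐ`:
for every `j`, the `j`-th columns of its elements form a generalized subdifferential mapping of
the `j`-th component of `h`. The product of arbitrary generalized subdifferentials of the
components is the basic example, but `D` need not be a product. -/
structure IsGenJacobian {n m : ℕ} (h : Vec n → Vec m) (D : Vec n → Set (Jac m n)) : Prop where
  nonempty : ∀ x, (D x).Nonempty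
  convex : ∀ x, Convex ℝ (D x)
  compact : ∀ x, IsCompact (D x)
  usc : UpperHemicontinuous D
  component : ∀ j, IsGenSubdiff (fun x => h x j)
    (fun x => (fun J : Jac m n => J (EuclideanSpace.single j 1)) '' D x)

/-! ### Convex and path-wise notions -/

/-- The normal cone to the convex set `K` at `x`; it is empty when `x ∉ K`. -/
def normalCone {E : Type*} [NormedAddCommGroup E] [InnerProductSpace ℝ E] (K : Set E) (x : E) :
    Set E :=
  {v | x ∈ K ∧ ∀ y ∈ K, ⟪v, y - x⟫_ℝ ≤ 0}

/-- `p : [0, ∞) → E` is absolutely continuous with weak derivative `p'`: `p'` is integrable on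
bounded intervals and `p t = p 0 + ∫₀ᵗ p'` for all `t ≥ 0`. Only the restrictions to `[0, ∞)`
matter. -/
def HasWeakDeriv {E : Type*} [NormedAddCommGroup E] [NormedSpace ℝ E] (p p' : ℝ → E) : Prop :=
  ∀ t, 0 ≤ t → IntervalIntegrable p' volume 0 t ∧ p t = p 0 + ∫ s in (0 : ℝ)..t, p' s

/-! ### The problem -/

/-- The data of a conditional stochastic optimization problem together with a parametric model
`Ψ` of the inner conditional expectation: base random vector `X`, dependent random vector `Y`,
feasible set `B`, inner function `f`, outer function `g`, and chosen generalized subdifferentials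
`∂f x y β`, `∂Ψ x θ` of `f x y` and `Ψ x`. -/
structure Problem (Ω : Type*) [MeasurableSpace Ω] (nX nY nβ nf nθ : ℕ) where
  P : Measure Ω
  isProb : IsProbabilityMeasure P
  X : Ω → Vec nX
  Y : Ω → Vec nY
  measurable_X : Measurable X
  measurable_Y : Measurable Y
  B : Set (Vec nβ)
  f : Vec nX → Vec nY → Vec nβ → Vec nf
  g : Vec nf → ℝ
  Ψ : Vec nX → Vec nθ → Vec nf
  measurable_f : ∀ β, Measurable fun xy : Vec nX × Vec nY => f xy.1 xy.2 β
  measurable_Ψ : ∀ θ, Measurable fun x => Ψ x θ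
  subdiff_f : Vec nX → Vec nY → Vec nβ → Set (Jac nf nβ)
  subdiff_Ψ : Vec nX → Vec nθ → Set (Jac nf nθ)

namespace Problem

variable {Ω : Type*} [MeasurableSpace Ω] {nX nY nβ nf nθ : ℕ}

/-- The σ-algebra generated by `X`. -/
abbrev sigmaX (p : Problem Ω nX nY nβ nf nθ) : MeasurableSpace Ω :=
  MeasurableSpace.comap p.X inferInstance

/-- `F(X, β) = 𝔼[f(X, Y, β) | X]`, as a random vector. -/
noncomputable def F (p : Problem Ω nX nY nβ nf nθ) (β : Vec nβ) : Ω → Vec nf :=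
  p.P[fun ω => p.f (p.X ω) (p.Y ω) β | p.sigmaX]

/-- The loss `G(β) = 𝔼[g(F(X, β))]`. -/
noncomputable def G (p : Problem Ω nX nY nβ nf nθ) (β : Vec nβ) : ℝ :=
  ∫ ω, p.g (p.F β ω) ∂p.P

/-- The mean squared error `Q(β, θ) = ½ 𝔼 ‖F(X, β) - Ψ(X, θ)‖²`. -/
noncomputable def Q (p : Problem Ω nX nY nβ nf nθ) (β : Vec nβ) (θ : Vec nθ) : ℝ :=
  1 / 2 * ∫ ω, ‖p.F β ω - p.Ψ (p.X ω) θ‖ ^ 2 ∂p.P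

/-- The regularized stochastic Bregman distance. -/
noncomputable def bregman (p : Problem Ω nX nY nβ nf nθ) (lam : ℝ) (β : Vec nβ) (θ : Vec nθ) :
    ℝ :=
  ∫ ω, (p.g (p.F β ω) - p.g (p.Ψ (p.X ω) θ)
    - ⟪gradient p.g (p.Ψ (p.X ω) θ), p.F β ω - p.Ψ (p.X ω) θ⟫_ℝ
    + lam / 2 * ‖p.F β ω - p.Ψ (p.X ω) θ‖ ^ 2) ∂p.P

/-- The Lyapunov function `w = G + α Δ^λ`. -/
noncomputable def w (p : Problem Ω nX nY nβ nf nθ) (α lam : ℝ) (z : Pair nβ nθ) : ℝ :=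
  p.G z.fst + α * p.bregman lam z.fst z.snd

/-- The generalized subdifferential `∂F(X, β) = 𝔼[∂f(X, Y, β) | X]`: the collection of
conditional expectations of all measurable selections. -/
def subdiffF (p : Problem Ω nX nY nβ nf nθ) (β : Vec nβ) : Set (Ω → Jac nf nβ) :=
  {J | ∃ s : Vec nX × Vec nY → Jac nf nβ, Measurable s ∧
    (∀ᵐ ω ∂p.P, s (p.X ω, p.Y ω) ∈ p.subdiff_f (p.X ω) (p.Y ω) β) ∧
    J = p.P[fun ω => s (p.X ω, p.Y ω) | p.sigmaX]}

/-- The measurable selections of `∂Ψ(X, θ)`. -/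
def selΨ (p : Problem Ω nX nY nβ nf nθ) (θ : Vec nθ) : Set (Vec nX → Jac nf nθ) :=
  {s | Measurable s ∧ ∀ᵐ ω ∂p.P, s (p.X ω) ∈ p.subdiff_Ψ (p.X ω) θ}

/-- `∂G(β) = 𝔼[∂F(X, β) ∇g(F(X, β))]`. -/
noncomputable def subdiffG (p : Problem Ω nX nY nβ nf nθ) (β : Vec nβ) : Set (Vec nβ) :=
  {d | ∃ J ∈ p.subdiffF β, d = ∫ ω, J ω (gradient p.g (p.F β ω)) ∂p.P}

/-- `∂_θ Q(β, θ) = -𝔼[∂Ψ(X, θ) (F(X, β) - Ψ(X, θ))]`. -/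
noncomputable def subdiffQθ (p : Problem Ω nX nY nβ nf nθ) (β : Vec nβ) (θ : Vec nθ) :
    Set (Vec nθ) :=
  {d | ∃ s ∈ p.selΨ θ, d = -∫ ω, s (p.X ω) (p.F β ω - p.Ψ (p.X ω) θ) ∂p.P}

/-- `Γ(β, θ)`, the set of mean directions
`𝔼 (-∂F(X, β) ∇g(Ψ(X, θ)), γ ∂Ψ(X, θ) (F(X, β) - Ψ(X, θ)))`. -/
noncomputable def directions (p : Problem Ω nX nY nβ nf nθ) (γ : ℝ) (z : Pair nβ nθ) :
    Set (Pair nβ nθ) :=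
  {d | ∃ J ∈ p.subdiffF z.fst, ∃ s ∈ p.selΨ z.snd, d = WithLp.toLp 2
    (-∫ ω, J ω (gradient p.g (p.Ψ (p.X ω) z.snd)) ∂p.P,
      γ • ∫ ω, s (p.X ω) (p.F z.fst ω - p.Ψ (p.X ω) z.snd) ∂p.P)}

/-- The domain `B × Θ_R`, where `Θ_R` is the closed ball of radius `R` about `0`. -/
def domain (p : Problem Ω nX nY nβ nf nθ) (R : ℝ) : Set (Pair nβ nθ) :=
  {z | z.fst ∈ p.B ∧ ‖z.snd‖ ≤ R}

/-- Stationary points: `β ∈ B` with `0 ∈ ∂G(β) + N_B(β)`. -/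
def Bstar (p : Problem Ω nX nY nβ nf nθ) : Set (Vec nβ) :=
  {β | β ∈ p.B ∧ (0 : Vec nβ) ∈ p.subdiffG β + normalCone p.B β}

/-- `Z* = {(β, θ) : β ∈ B*, Q(β, θ) = 0}`. -/
def Zstar (p : Problem Ω nX nY nβ nf nθ) : Set (Pair nβ nθ) :=
  {z | z.fst ∈ p.Bstar ∧ p.Q z.fst z.snd = 0}

/-- `Z` is an absolutely continuous solution on `[0, ∞)` of the differential inclusion
`Z' ∈ Γ(Z) - N_{B × Θ_R}(Z)` (for almost every `t ≥ 0`). -/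
def IsSolution (p : Problem Ω nX nY nβ nf nθ) (γ R : ℝ) (Z : ℝ → Pair nβ nθ) : Prop :=
  ∃ Z' : ℝ → Pair nβ nθ, HasWeakDeriv Z Z' ∧
    ∀ᵐ t ∂(volume.restrict (Ici (0 : ℝ))),
      Z' t ∈ p.directions γ (Z t) - normalCone (p.domain R) (Z t)

/-! ### The assumptions -/

/-- The feasible set is convex and compact. -/
structure A1 (p : Problem Ω nX nY nβ nf nθ) : Prop where
  convex : Convex ℝ p.B
  compact : IsCompact p.B

/-- Smoothness of the outer function; `L` is the Lipschitz constant of `∇g`. -/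
structure A2 (p : Problem Ω nX nY nβ nf nθ) (L : ℝ) : Prop where
  contDiff : ContDiff ℝ 1 p.g
  genDiff : GenDifferentiable (gradient p.g)
  bound : ∃ Lg : ℝ, ∀ u, ‖gradient p.g u‖ ≤ Lg
  lipschitz : ∀ u v, ‖gradient p.g u - gradient p.g v‖ ≤ L * ‖u - v‖

/-- Generalized differentiability and moment bounds for `f`; `Lf` bounds the fourth moment of
the subgradients. -/
structure A3 (p : Problem Ω nX nY nβ nf nθ) (Lf : ℝ) : Prop where
  genDiff : ∀ x y, IsGenJacobian (p.f x y) (p.subdiff_f x y)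
  pos : 0 < Lf
  subgrad : ∃ ℓ : Vec nX → Vec nY → ℝ,
    (∀ β ∈ p.B, ∀ x y, ∀ J ∈ p.subdiff_f x y β, ‖J‖ ≤ ℓ x y) ∧
    Integrable (fun ω => ℓ (p.X ω) (p.Y ω) ^ 4) p.P ∧
    ∫ ω, ℓ (p.X ω) (p.Y ω) ^ 4 ∂p.P ≤ Lf ^ 4
  moment : ∃ C : ℝ, 0 < C ∧ ∀ β ∈ p.B,
    Integrable (fun ω => ‖p.f (p.X ω) (p.Y ω) β‖ ^ 4) p.P ∧
    ∫ ω, ‖p.f (p.X ω) (p.Y ω) β‖ ^ 4 ∂p.P ≤ C ^ 4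

/-- Generalized differentiability and moment bounds for `Ψ`; `LΨ` bounds the fourth moment of
the subgradients. -/
structure A4 (p : Problem Ω nX nY nβ nf nθ) (LΨ : ℝ) : Prop where
  genDiff : ∀ x, IsGenJacobian (p.Ψ x) (p.subdiff_Ψ x)
  pos : 0 < LΨ
  subgrad : ∃ ℓ : Vec nX → ℝ,
    (∀ x θ, ∀ J ∈ p.subdiff_Ψ x θ, ‖J‖ ≤ ℓ x) ∧
    Integrable (fun ω => ℓ (p.X ω) ^ 4) p.P ∧
    ∫ ω, ℓ (p.X ω) ^ 4 ∂p.P ≤ LΨ ^ 4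
  moment : ∃ C : ℝ, 0 < C ∧ ∃ θ₀ : Vec nθ,
    Integrable (fun ω => ‖p.Ψ (p.X ω) θ₀‖ ^ 4) p.P ∧
    ∫ ω, ‖p.Ψ (p.X ω) θ₀‖ ^ 4 ∂p.P ≤ C ^ 4

/-- The uniform Łojasiewicz-type growth condition with constant `M`. -/
structure A5 (p : Problem Ω nX nY nβ nf nθ) (M : ℝ) : Prop where
  pos : 0 < M
  growth : ∀ β ∈ p.B, ∀ θ, p.Q β θ ≤ M * Metric.infDist 0 (p.subdiffQθ β θ) ^ 2

/-- Behaviour of the tracking error for large `θ`. -/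
structure A6 (p : Problem Ω nX nY nβ nf nθ) (Rlow : ℝ) : Prop where
  pos : 0 < Rlow
  inward : ∀ β ∈ p.B, ∀ θ, Rlow ≤ ‖θ‖ → ∀ q ∈ p.subdiffQθ β θ, 0 < ⟪θ, q⟫_ℝ

end Problem

end CondStochOpt

/-! Seen in L², `w` is a fixed function of u = F(X, β) and v = Ψ(X, θ), namely `lyapunov` with G(u)
= 𝔼 g(u) and A = ∇g taken pointwise (`w_eq_lyapunov`). It is Lipschitz on bounded sets, and u, v are
Lipschitz in β, θ, so W varies at most like Z and is absolutely continuous (`abs_w_sub_le`,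
`exists_of_abs_sub_le`).

The sign of W' needs a chain rule along a nonsmooth path. The generalized expansion at x uses
Jacobians at the neighbouring point y, so difference quotients along times ts → t have a known limit
as soon as the selections used at ts converge to the one used at t. The selections are chosen at
each time with no regularity in t. However, L² over the laws of (X, Y) and X is separable, so
outside countably many t the triple (t, σ t, τ t) is a limit of such triples at other times
(`exists_seq_tendsto_selections`). One sequence suffices, since Z and W are differentiable almost
everywhere. It gives u' = 𝔼[σᵀβ' | X] and v' = τᵀθ'.

The normal vector to B is orthogonal to β', because the path stays in B on both sides of t, and (A6)
removes the normal component in θ, so θ' = γ d. Hence ⟪A v, u'⟫ = -‖β'‖² and ⟪u - v, v'⟫ = γ‖d‖².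
The Lipschitz bound on A then bounds W' by a quadratic expression in ‖β'‖, ‖d‖ and q = ‖u - v‖
(`le_of_tendsto_lyapunov`, `lyapunov_decrease`). By (A5), q² ≤ 2M‖d‖², and the conditions on λ and γ
make the expression negative unless β' = 0 and d = 0 (`dissipation_le`). In that case Q = 0, so F =
Ψ almost surely, and the equation for β' becomes stationarity of β. -/

namespace CondStochOpt

/-! ### Calculus of generalized Jacobians -/

lemma norm_le_sum_abs {m : ℕ} (v : Vec m) : ‖v‖ ≤ ∑ j, |v j| := by
  rw [EuclideanSpace.norm_eq]
  apply Real.sqrt_le_iff.2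
  refine ⟨Finset.sum_nonneg fun _ _ => abs_nonneg _, ?_⟩
  simpa using Finset.sum_sq_le_sq_sum_of_nonneg (s := Finset.univ) (f := fun j => |v j|)
    (fun _ _ => abs_nonneg _)

/-- Jacobians are stored transposed, so displacements are acted on by the adjoint; this links it to
the columns. -/
lemma adjoint_apply_coord {m n : ℕ} (J : Jac m n) (w : Vec n) (j : Fin m) :
    (ContinuousLinearMap.adjoint J w) j = ⟪J (EuclideanSpace.single j 1), w⟫_ℝ := by
  rw [← ContinuousLinearMap.adjoint_inner_right]
  simp [EuclideanSpace.inner_single_left]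

lemma norm_adjoint_apply_le {m n : ℕ} (J : Jac m n) (w : Vec n) :
    ‖ContinuousLinearMap.adjoint J w‖ ≤ ‖J‖ * ‖w‖ := by
  simpa using (ContinuousLinearMap.adjoint J).le_opNorm w

lemma tendsto_clm_apply {ι E F : Type*} [NormedAddCommGroup E] [NormedSpace ℝ E]
    [NormedAddCommGroup F] [NormedSpace ℝ F] {l : Filter ι} {T : ι → E →L[ℝ] F} {T₀ : E →L[ℝ] F}
    {x : ι → E} {x₀ : E} (hT : Tendsto T l (𝓝 T₀)) (hx : Tendsto x l (𝓝 x₀)) :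
    Tendsto (fun i => T i (x i)) l (𝓝 (T₀ x₀)) := by
  have hc : Continuous fun q : (E →L[ℝ] F) × E => q.1 q.2 := isBoundedBilinearMap_apply.continuous
  exact (hc.tendsto (T₀, x₀)).comp (hT.prodMk_nhds hx)

namespace IsGenJacobian

variable {n m : ℕ} {h : Vec n → Vec m} {D : Vec n → Set (Jac m n)}

lemma expansion (hD : IsGenJacobian h D) (x : Vec n) {ε : ℝ} (hε : 0 < ε) :
    ∀ᶠ y in 𝓝 x, ∀ J ∈ D y,
      ‖h y - h x - ContinuousLinearMap.adjoint J (y - x)‖ ≤ ε * ‖y - x‖ := by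
  have hm : (0 : ℝ) < m + 1 := by positivity
  -- The `m` componentwise errors must sum to at most ε; the `+ 1` covers `m = 0`.
  have key : ∀ᶠ y in 𝓝 x, ∀ j : Fin m, ∀ J ∈ D y,
      |h y j - h x j - ⟪J (EuclideanSpace.single j 1), y - x⟫_ℝ| ≤ ε / (m + 1) * ‖y - x‖ := by
    rw [eventually_all]
    intro j
    filter_upwards [(hD.component j).expansion x (ε / (m + 1)) (by positivity)] with y hy J hJ
    exact hy _ ⟨J, hJ, rfl⟩
  filter_upwards [key] with y hy J hJ
  refine (norm_le_sum_abs _).trans ?_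
  calc ∑ j, |(h y - h x - ContinuousLinearMap.adjoint J (y - x)) j|
      ≤ ∑ _j : Fin m, ε / (m + 1) * ‖y - x‖ := by
        refine Finset.sum_le_sum fun j _ => ?_
        have := hy j J hJ
        simpa [adjoint_apply_coord, inner_sub_right] using this
    _ = (m / (m + 1)) * (ε * ‖y - x‖) := by
        simp; ring
    _ ≤ 1 * (ε * ‖y - x‖) := by
        gcongr
        rw [div_le_one hm]; linarith
    _ = _ := one_mul _

lemma eventually_norm_sub_le (hD : IsGenJacobian h D) {K : Set (Vec n)} {L : ℝ}
    (hL : ∀ x ∈ K, ∀ J ∈ D x, ‖J‖ ≤ L) (x : Vec n) {ε : ℝ} (hε : 0 < ε) :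
    ∀ᶠ y in 𝓝 x, y ∈ K → ‖h y - h x‖ ≤ (L + ε) * ‖y - x‖ := by
  filter_upwards [hD.expansion x hε] with y hy hyK
  obtain ⟨J, hJ⟩ := hD.nonempty y
  have h1 := hy J hJ
  have h2 := norm_adjoint_apply_le J (y - x)
  have h3 : ‖J‖ * ‖y - x‖ ≤ L * ‖y - x‖ := by gcongr; exact hL y hyK J hJ
  have h4 := norm_add_le (h y - h x - ContinuousLinearMap.adjoint J (y - x))
    (ContinuousLinearMap.adjoint J (y - x))
  rw [sub_add_cancel] at h4
  linarith [add_mul L ε ‖y - x‖]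

/-- A mean value inequality without derivatives: on the segment from `x` to `y` the local estimate
bounds the right slopes, and a comparison principle integrates it. -/
lemma norm_sub_le (hD : IsGenJacobian h D) {K : Set (Vec n)} (hK : Convex ℝ K) {L : ℝ}
    (hL : ∀ x ∈ K, ∀ J ∈ D x, ‖J‖ ≤ L) {x y : Vec n} (hx : x ∈ K) (hy : y ∈ K) :
    ‖h y - h x‖ ≤ L * ‖y - x‖ := by
  have hL0 : 0 ≤ L := by
    obtain ⟨J, hJ⟩ := hD.nonempty x
    exact (norm_nonneg J).trans (hL x hx J hJ)
  set c : ℝ → Vec n := fun t => x + t • (y - x) with hc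
  have hcc : Continuous c := by fun_prop
  have hcK : ∀ t ∈ Icc (0 : ℝ) 1, c t ∈ K := fun t ht => hK.add_smul_sub_mem hx hy ht
  have hcs : ∀ s t, c t - c s = (t - s) • (y - x) := fun s t => by
    simp only [hc, sub_smul]; abel
  have loc : ∀ t, ∀ ε > 0, ∀ᶠ s in 𝓝 t, s ∈ Icc (0 : ℝ) 1 →
      ‖h (c s) - h (c t)‖ ≤ (L + ε) * (|s - t| * ‖y - x‖) := by
    intro t ε hε
    filter_upwards [(hcc.tendsto t).eventually (hD.eventually_norm_sub_le hL (c t) hε)]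
      with s hs hsI
    simpa [hcs, norm_smul] using hs (hcK s hsI)
  have hcont : ContinuousOn (fun t => h (c t) - h x) (Icc 0 1) := by
    refine ContinuousOn.sub (fun t ht => ?_) continuousOn_const
    rw [ContinuousWithinAt, tendsto_iff_norm_sub_tendsto_zero]
    refine squeeze_zero' (Eventually.of_forall fun _ => norm_nonneg _)
      (eventually_nhdsWithin_iff.2 (loc t 1 one_pos)) ?_
    have : Tendsto (fun s : ℝ => (L + 1) * (|s - t| * ‖y - x‖)) (𝓝 t)
        (𝓝 ((L + 1) * (|t - t| * ‖y - x‖))) := by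
      apply Continuous.tendsto; fun_prop
    simpa using this.mono_left nhdsWithin_le_nhds
  -- The comparison principle wants the barrier to grow strictly faster than the slope bound; ε is
  -- this slack and is sent to 0 at the end.
  have main : ∀ ε > 0, ‖h y - h x‖ ≤ (L * ‖y - x‖ + ε) * 1 := by
    intro ε hε
    have := image_norm_le_of_liminf_right_slope_norm_lt_deriv_boundary (a := (0 : ℝ)) (b := 1)
      (f' := fun _ => L * ‖y - x‖) (B := fun t => (L * ‖y - x‖ + ε) * t)
      (B' := fun _ => L * ‖y - x‖ + ε) hcont ?_ ?_ (by fun_prop) ?_ (by intros; linarith)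
      (right_mem_Icc.2 zero_le_one)
    · simpa [hc] using this
    · intro t ht r hr
      -- η spends at most half of the gap `r - L * ‖y - x‖`; the `+ 1` in its denominator covers `x
      -- = y`.
      obtain ⟨η, hη, hηr⟩ : ∃ η > 0, (L + η) * ‖y - x‖ < r := by
        refine ⟨(r - L * ‖y - x‖) / (2 * (‖y - x‖ + 1)), by
          apply div_pos <;> [linarith; positivity], ?_⟩
        have h1 : (r - L * ‖y - x‖) / (2 * (‖y - x‖ + 1)) * ‖y - x‖
            ≤ (r - L * ‖y - x‖) / 2 := by
          rw [div_mul_eq_mul_div, div_le_div_iff₀ (by positivity) (by positivity)]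
          nlinarith [norm_nonneg (y - x)]
        linarith [add_mul L ((r - L * ‖y - x‖) / (2 * (‖y - x‖ + 1))) ‖y - x‖]
      apply Eventually.frequently
      have hI : ∀ᶠ s in 𝓝[>] t, s ∈ Ioo t 1 := Ioo_mem_nhdsGT ht.2
      filter_upwards [(loc t η hη).filter_mono nhdsWithin_le_nhds, hI] with s hs hsI
      have hpos : 0 < s - t := sub_pos.2 hsI.1
      have h1 := hs ⟨ht.1.trans hsI.1.le, hsI.2.le⟩
      rw [abs_of_pos hpos] at h1
      have h2 : ‖h (c s) - h x‖ - ‖h (c t) - h x‖ ≤ ‖h (c s) - h (c t)‖ := by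
        have := norm_sub_norm_le (h (c s) - h x) (h (c t) - h x)
        simpa using this
      rw [slope_def_field, Function.comp, Function.comp, div_lt_iff₀ hpos]
      nlinarith
    · simp [hc]
    · intro t _
      simpa using ((hasDerivAt_id t).const_mul (L * ‖y - x‖ + ε)).hasDerivWithinAt
  refine le_of_forall_pos_le_add fun ε hε => ?_
  simpa using main ε hε

/-- The remainder is o(‖xs k - x‖), and dividing by `δ k` keeps it small because the quotients of
`xs` are bounded. -/
lemma tendsto_slope (hD : IsGenJacobian h D) {x v : Vec n} {xs : ℕ → Vec n} {δ : ℕ → ℝ}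
    (hxs : Tendsto xs atTop (𝓝 x))
    (hv : Tendsto (fun k => (δ k)⁻¹ • (xs k - x)) atTop (𝓝 v))
    {σ : Jac m n} {σs : ℕ → Jac m n} (hσs : ∀ k, σs k ∈ D (xs k))
    (hσ : Tendsto σs atTop (𝓝 σ)) :
    Tendsto (fun k => (δ k)⁻¹ • (h (xs k) - h x)) atTop
      (𝓝 (ContinuousLinearMap.adjoint σ v)) := by
  have h1 : Tendsto (fun k => ContinuousLinearMap.adjoint (σs k) ((δ k)⁻¹ • (xs k - x))) atTop
      (𝓝 (ContinuousLinearMap.adjoint σ v)) := by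
    have h0 : Tendsto (fun k => ContinuousLinearMap.adjoint (σs k)) atTop
        (𝓝 (ContinuousLinearMap.adjoint σ)) :=
      (ContinuousLinearMap.adjoint.continuous.tendsto σ).comp hσ
    exact tendsto_clm_apply h0 hv
  have h2 : Tendsto (fun k => (δ k)⁻¹ • (h (xs k) - h x)
      - ContinuousLinearMap.adjoint (σs k) ((δ k)⁻¹ • (xs k - x))) atTop (𝓝 0) := by
    rw [Metric.tendsto_nhds]
    intro ε hε
    have hb : ∀ᶠ k in atTop, ‖(δ k)⁻¹ • (xs k - x)‖ < ‖v‖ + 1 :=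
      hv.norm.eventually (gt_mem_nhds (by linarith))
    have hv0 : 0 < ‖v‖ + 1 := by positivity
    filter_upwards [hb, hxs.eventually (hD.expansion x (ε := ε / (‖v‖ + 1)) (by positivity))]
      with k hk1 hk2
    have := hk2 _ (hσs k)
    rw [dist_zero_right, ContinuousLinearMap.map_smul, ← smul_sub, norm_smul]
    rw [norm_smul] at hk1
    calc ‖(δ k)⁻¹‖ * _ ≤ ‖(δ k)⁻¹‖ * (ε / (‖v‖ + 1) * ‖xs k - x‖) := by gcongr
      _ = ε / (‖v‖ + 1) * (‖(δ k)⁻¹‖ * ‖xs k - x‖) := by ring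
      _ < ε / (‖v‖ + 1) * (‖v‖ + 1) := by gcongr
      _ = ε := by field_simp
  simpa using h2.add h1

end IsGenJacobian

/-! ### Accumulation points of a family indexed by an arbitrary set -/

/-- Around each exceptional `e t` some basic open set contains no `e t'` with another index. These
sets differ for different `t`, and the basis is countable. Since the index, not the point, is
removed, a repeated value counts as accumulation. -/
lemma countable_setOf_notMem_closure_image {α E : Type*} [TopologicalSpace E]
    [SecondCountableTopology E] (e : α → E) (T : Set α) :
    {t | t ∈ T ∧ e t ∉ closure (e '' (T \ {t}))}.Countable := by
  set b := TopologicalSpace.countableBasis E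
  have hb := TopologicalSpace.isBasis_countableBasis E
  have key : ∀ t ∈ {t | t ∈ T ∧ e t ∉ closure (e '' (T \ {t}))},
      ∃ U ∈ b, e t ∈ U ∧ ∀ t' ∈ T, e t' ∈ U → t' = t := by
    rintro t ⟨-, ht⟩
    rw [hb.mem_closure_iff] at ht
    push Not at ht
    obtain ⟨U, hU, htU, hUe⟩ := ht
    refine ⟨U, hU, htU, fun t' ht' ht'U => ?_⟩
    by_contra hne
    have : e t' ∈ U ∩ e '' (T \ {t}) := ⟨ht'U, t', ⟨ht', hne⟩, rfl⟩
    simp [hUe] at this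
  choose! U hU htU hun using key
  refine MapsTo.countable_of_injOn (f := U) (t := b) (fun t ht => hU t ht) ?_
    (TopologicalSpace.countable_countableBasis E)
  intro t ht t' ht' heq
  exact hun t' ht' t ht.1 (heq ▸ htU t ht)

/-! ### Absolutely continuous paths -/

namespace HasWeakDeriv

variable {E : Type*} [NormedAddCommGroup E] [NormedSpace ℝ E] {p p' : ℝ → E}

lemma sub_eq (h : HasWeakDeriv p p') {s t : ℝ} (hs : 0 ≤ s) (ht : 0 ≤ t) :
    p t - p s = ∫ r in s..t, p' r := by
  rw [(h s hs).2, (h t ht).2, add_sub_add_left_eq_sub,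
    intervalIntegral.integral_interval_sub_left (h t ht).1 (h s hs).1]

/-- Lebesgue differentiation on each [0, N]. Time 0 is excluded because `p` is uncontrolled to its
left. -/
lemma ae_hasDerivAt [CompleteSpace E] (h : HasWeakDeriv p p') :
    ∀ᵐ t ∂(volume.restrict (Ici (0 : ℝ))), 0 < t ∧ HasDerivAt p (p' t) t := by
  rw [ae_restrict_iff' measurableSet_Ici]
  have h0 : ∀ᵐ t : ℝ, t ≠ 0 := by simp [ae_iff, measure_singleton]
  have hN : ∀ᵐ t : ℝ, ∀ N : ℕ, t ∈ uIcc (0 : ℝ) N → ∀ c ∈ uIcc (0 : ℝ) N,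
      HasDerivAt (fun x => ∫ r in c..x, p' r) (p' t) t :=
    ae_all_iff.2 fun N => (h N N.cast_nonneg).1.ae_hasDerivAt_integral
  filter_upwards [h0, hN] with t ht0 htN (ht : 0 ≤ t)
  have htp : 0 < t := lt_of_le_of_ne ht (Ne.symm ht0)
  obtain ⟨N, hN⟩ := exists_nat_ge t
  refine ⟨htp, ?_⟩
  have := (htN N (by rw [uIcc_of_le N.cast_nonneg]; exact ⟨ht, hN⟩) 0 left_mem_uIcc).const_add (p 0)
  refine this.congr_of_eventuallyEq ?_
  filter_upwards [lt_mem_nhds htp] with s hs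
  exact (h s hs.le).2

lemma continuousOn (h : HasWeakDeriv p p') : ContinuousOn p (Ici 0) := by
  intro t ht
  have ht1 : (0 : ℝ) ≤ t + 1 := by have : (0 : ℝ) ≤ t := ht; linarith
  have h1 : ContinuousOn (fun s => p 0 + ∫ r in (0 : ℝ)..s, p' r) (uIcc 0 (t + 1)) :=
    continuousOn_const.add (intervalIntegral.continuousOn_primitive_interval'
      (h (t + 1) ht1).1 left_mem_uIcc)
  rw [uIcc_of_le ht1] at h1
  have h2 : ContinuousOn p (Icc 0 (t + 1)) := h1.congr fun s hs => (h s hs.1).2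
  refine (h2 t ⟨ht, by linarith⟩).mono_of_mem_nhdsWithin ?_
  have : Iic (t + 1) ∈ 𝓝[Ici 0] t := mem_nhdsWithin_of_mem_nhds (Iic_mem_nhds (by linarith))
  filter_upwards [self_mem_nhdsWithin, this] with s h1 h2 using ⟨h1, h2⟩

/-- A real function that varies at most like an absolutely continuous path is absolutely
continuous. -/
lemma exists_of_abs_sub_le (h : HasWeakDeriv p p') {W : ℝ → ℝ} {C : ℝ}
    (hW : ∀ s t, 0 ≤ s → 0 ≤ t → |W t - W s| ≤ C * ‖p t - p s‖) :
    HasWeakDeriv W (deriv W) := by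
  have hC : ∀ s t, 0 ≤ s → 0 ≤ t → |W t - W s| ≤ |C| * ‖p t - p s‖ := fun s t hs ht =>
    (hW s t hs ht).trans (by gcongr; exact le_abs_self C)
  intro T hT
  -- The primitive of ‖p'‖ dominates the increments of `p`, so `W` inherits absolute continuity from
  -- this real function.
  set N : ℝ → ℝ := fun x => ∫ r in (0 : ℝ)..x, ‖p' r‖ with hN
  have hNac : AbsolutelyContinuousOnInterval N 0 T :=
    (h T hT).1.norm.absolutelyContinuousOnInterval_intervalIntegral left_mem_uIcc
  have hbound : ∀ s ∈ uIcc 0 T, ∀ t ∈ uIcc 0 T, dist (W s) (W t) ≤ |C| * dist (N s) (N t) := by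
    intro s hs t ht
    rw [uIcc_of_le hT] at hs ht
    rw [dist_comm, Real.dist_eq, dist_comm (N s), Real.dist_eq]
    refine (hC s t hs.1 ht.1).trans ?_
    gcongr
    rw [h.sub_eq hs.1 ht.1, hN]
    simp only
    rw [intervalIntegral.integral_interval_sub_left (h t ht.1).1.norm (h s hs.1).1.norm]
    exact intervalIntegral.norm_integral_le_abs_integral_norm
  have hac : AbsolutelyContinuousOnInterval W 0 T := by
    unfold AbsolutelyContinuousOnInterval at hNac ⊢
    have h0 := hNac.const_mul |C|
    rw [mul_zero] at h0
    refine squeeze_zero' (Eventually.of_forall fun _ =>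
      Finset.sum_nonneg fun _ _ => dist_nonneg) ?_ h0
    have : ∀ᶠ E in AbsolutelyContinuousOnInterval.totalLengthFilter ⊓
        𝓟 (AbsolutelyContinuousOnInterval.disjWithin 0 T),
        E ∈ AbsolutelyContinuousOnInterval.disjWithin 0 T :=
      mem_inf_of_right (mem_principal_self _)
    filter_upwards [this] with E hE
    rw [Finset.mul_sum]
    refine Finset.sum_le_sum fun i hi => hbound _ (hE.1 i hi).1 _ (hE.1 i hi).2
  refine ⟨hac.intervalIntegrable_deriv, ?_⟩
  rw [hac.integral_deriv_eq_sub]; ring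

end HasWeakDeriv

/-! ### The Lyapunov function on a Hilbert space -/

section Hilbert

variable {H : Type*} [NormedAddCommGroup H] [InnerProductSpace ℝ H]

/-- The Lyapunov function as a function of the inner expectation `u` and of the model output `v`,
where `A` plays the role of the gradient of `G`. -/
noncomputable def lyapunov (G : H → ℝ) (A : H → H) (α lam : ℝ) (u v : H) : ℝ :=
  G u + α * (G u - G v - ⟪A v, u - v⟫_ℝ + lam / 2 * ‖u - v‖ ^ 2)

/-- The remainder in the first order expansion of `lyapunov`. -/
lemma lyapunov_sub (G : H → ℝ) (A : H → H) (α lam : ℝ) (u v u₁ v₁ : H) :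
    lyapunov G A α lam u₁ v₁ - lyapunov G A α lam u v =
      (1 + α) * ⟪A u, u₁ - u⟫_ℝ - α * ⟪A v, u₁ - u⟫_ℝ
      - α * ⟪A v₁ - A v, u₁ - v₁⟫_ℝ + α * lam * ⟪u - v, (u₁ - u) - (v₁ - v)⟫_ℝ
      + ((1 + α) * (G u₁ - G u - ⟪A u, u₁ - u⟫_ℝ) - α * (G v₁ - G v - ⟪A v, v₁ - v⟫_ℝ)
      + α * lam / 2 * ‖(u₁ - u) - (v₁ - v)‖ ^ 2) := by
  have h1 : ‖u₁ - v₁‖ ^ 2 = ‖u - v‖ ^ 2 + 2 * ⟪u - v, (u₁ - u) - (v₁ - v)⟫_ℝ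
      + ‖(u₁ - u) - (v₁ - v)‖ ^ 2 := by
    rw [← norm_add_sq_real]; congr 2; abel
  unfold lyapunov
  rw [h1]
  simp only [inner_sub_left, inner_sub_right]
  ring

variable {G : H → ℝ} {A : H → H} {L C : ℝ}

-- On a ball `A` is bounded by its value at 0 plus `|L| * r`. Every term of `lyapunov_sub` then has
-- one factor linear in the increments and the rest bounded.
set_option maxHeartbeats 800000 in
lemma abs_lyapunov_sub_le
    (hG : ∀ u v, |G v - G u - ⟪A u, v - u⟫_ℝ| ≤ C * ‖v - u‖ ^ 2)
    (hA : ∀ u v, ‖A u - A v‖ ≤ L * ‖u - v‖) (α lam r : ℝ) :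
    ∃ c, ∀ u v u₁ v₁ : H, ‖u‖ ≤ r → ‖v‖ ≤ r → ‖u₁‖ ≤ r → ‖v₁‖ ≤ r →
      |lyapunov G A α lam u₁ v₁ - lyapunov G A α lam u v| ≤ c * (‖u₁ - u‖ + ‖v₁ - v‖) := by
  by_cases hr : 0 ≤ r
  swap
  · exact ⟨0, fun u _ _ _ hu => absurd ((norm_nonneg u).trans hu) hr⟩
  set a := ‖A 0‖ + |L| * r with ha
  have ha0 : 0 ≤ a := by positivity
  have hAb : ∀ u : H, ‖u‖ ≤ r → ‖A u‖ ≤ a := by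
    intro u hu
    have h1 := hA u 0
    have h2 := norm_add_le (A u - A 0) (A 0)
    rw [sub_add_cancel] at h2
    rw [sub_zero] at h1
    have h3 : L * ‖u‖ ≤ |L| * r := by
      calc L * ‖u‖ ≤ |L| * ‖u‖ := by gcongr; exact le_abs_self L
        _ ≤ _ := by gcongr
    linarith
  refine ⟨|1 + α| * a + |α| * a + |α| * (|L| * (2 * r)) + |α * lam| * (2 * r) +
    (|1 + α| * (|C| * (2 * r)) + |α| * (|C| * (2 * r)) + |α * lam / 2| * (4 * r)),
    fun u v u₁ v₁ hu hv hu₁ hv₁ => ?_⟩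
  set x := ‖u₁ - u‖ with hx
  set y := ‖v₁ - v‖ with hy
  have hx0 : 0 ≤ x := norm_nonneg _
  have hy0 : 0 ≤ y := norm_nonneg _
  have hx2 : x ≤ 2 * r := (_root_.norm_sub_le _ _).trans (by linarith)
  have hy2 : y ≤ 2 * r := (_root_.norm_sub_le _ _).trans (by linarith)
  have hxy : ‖(u₁ - u) - (v₁ - v)‖ ≤ x + y := _root_.norm_sub_le _ _
  have e1 : |⟪A u, u₁ - u⟫_ℝ| ≤ a * (x + y) :=
    (abs_real_inner_le_norm _ _).trans (by gcongr; exacts [hAb u hu, by linarith])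
  have e2 : |⟪A v, u₁ - u⟫_ℝ| ≤ a * (x + y) :=
    (abs_real_inner_le_norm _ _).trans (by gcongr; exacts [hAb v hv, by linarith])
  have e3 : |⟪A v₁ - A v, u₁ - v₁⟫_ℝ| ≤ |L| * (2 * r) * (x + y) := by
    have h1 : ‖u₁ - v₁‖ ≤ 2 * r := (_root_.norm_sub_le _ _).trans (by linarith)
    have h2 : ‖A v₁ - A v‖ ≤ |L| * (x + y) :=
      (hA _ _).trans (by
        calc L * ‖v₁ - v‖ ≤ |L| * y := by gcongr; exact le_abs_self L
          _ ≤ _ := by gcongr; linarith)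
    refine (abs_real_inner_le_norm _ _).trans ?_
    calc ‖A v₁ - A v‖ * ‖u₁ - v₁‖ ≤ |L| * (x + y) * (2 * r) := by gcongr
      _ = _ := by ring
  have e4 : |⟪u - v, (u₁ - u) - (v₁ - v)⟫_ℝ| ≤ 2 * r * (x + y) :=
    (abs_real_inner_le_norm _ _).trans (by
      gcongr; exact (_root_.norm_sub_le _ _).trans (by linarith))
  have e5 : |G u₁ - G u - ⟪A u, u₁ - u⟫_ℝ| ≤ |C| * (2 * r) * (x + y) := by
    refine (hG _ _).trans ?_
    calc C * ‖u₁ - u‖ ^ 2 ≤ |C| * (x * x) := by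
          rw [sq]; gcongr; exact le_abs_self C
      _ ≤ |C| * ((2 * r) * (x + y)) := by gcongr; linarith
      _ = _ := by ring
  have e6 : |G v₁ - G v - ⟪A v, v₁ - v⟫_ℝ| ≤ |C| * (2 * r) * (x + y) := by
    refine (hG _ _).trans ?_
    calc C * ‖v₁ - v‖ ^ 2 ≤ |C| * (y * y) := by
          rw [sq]; gcongr; exact le_abs_self C
      _ ≤ |C| * ((2 * r) * (x + y)) := by gcongr; linarith
      _ = _ := by ring
  have e7 : |‖(u₁ - u) - (v₁ - v)‖ ^ 2| ≤ 4 * r * (x + y) := by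
    rw [abs_of_nonneg (by positivity), sq]
    calc _ ≤ (x + y) * (x + y) := by gcongr
      _ ≤ (4 * r) * (x + y) := by gcongr; linarith
  have mul_abs : ∀ {k b B : ℝ}, |b| ≤ B → |k * b| ≤ |k| * B := fun {k b B} h => by
    rw [abs_mul]; gcongr
  rw [lyapunov_sub]
  have f1 := mul_abs (k := 1 + α) e1
  have f2 := mul_abs (k := α) e2
  have f3 := mul_abs (k := α) e3
  have f4 := mul_abs (k := α * lam) e4
  have f5 := mul_abs (k := 1 + α) e5
  have f6 := mul_abs (k := α) e6
  have f7 := mul_abs (k := α * lam / 2) e7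
  rw [abs_le] at f1 f2 f3 f4 f5 f6 f7 ⊢
  constructor <;> linarith

/-- Upper bound for a limit of difference quotients of `lyapunov`. -/
lemma le_of_tendsto_lyapunov
    (hG : ∀ u v, |G v - G u - ⟪A u, v - u⟫_ℝ| ≤ C * ‖v - u‖ ^ 2)
    (hA : ∀ u v, ‖A u - A v‖ ≤ L * ‖u - v‖) {α lam : ℝ} (hα : 0 ≤ α)
    {u v u' v' : H} {us vs : ℕ → H} {δ : ℕ → ℝ} {W' : ℝ}
    (hδ : Tendsto δ atTop (𝓝 0)) (hδ0 : ∀ k, δ k ≠ 0)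
    (hu : Tendsto (fun k => (δ k)⁻¹ • (us k - u)) atTop (𝓝 u'))
    (hv : Tendsto (fun k => (δ k)⁻¹ • (vs k - v)) atTop (𝓝 v'))
    (hW : Tendsto (fun k => (δ k)⁻¹ *
      (lyapunov G A α lam (us k) (vs k) - lyapunov G A α lam u v)) atTop (𝓝 W')) :
    W' ≤ (1 + α) * ⟪A u, u'⟫_ℝ - α * ⟪A v, u'⟫_ℝ + α * (L * ‖v'‖ * ‖u - v‖)
      + α * lam * ⟪u - v, u' - v'⟫_ℝ := by
  set du : ℕ → H := fun k => (δ k)⁻¹ • (us k - u) with hdu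
  set dv : ℕ → H := fun k => (δ k)⁻¹ • (vs k - v) with hdv
  have eu : ∀ k, us k - u = δ k • du k := fun k => by simp [hdu, smul_smul, hδ0 k]
  have ev : ∀ k, vs k - v = δ k • dv k := fun k => by simp [hdv, smul_smul, hδ0 k]
  have bound : ∀ k, (δ k)⁻¹ * (lyapunov G A α lam (us k) (vs k) - lyapunov G A α lam u v) ≤
      (1 + α) * ⟪A u, du k⟫_ℝ - α * ⟪A v, du k⟫_ℝ
      + α * (L * ‖dv k‖ * ‖(u - v) + δ k • (du k - dv k)‖)
      + α * lam * ⟪u - v, du k - dv k⟫_ℝ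
      + |δ k| * (|1 + α| * (C * ‖du k‖ ^ 2) + |α| * (C * ‖dv k‖ ^ 2)
        + |α * lam / 2| * ‖du k - dv k‖ ^ 2) := by
    intro k
    have hδk := hδ0 k
    have hpos : 0 < |δ k| := abs_pos.2 hδk
    have inv_sq : ∀ x : H, |(δ k)⁻¹| * ‖δ k • x‖ ^ 2 = |δ k| * ‖x‖ ^ 2 := fun x => by
      rw [norm_smul, Real.norm_eq_abs, abs_inv]; field_simp
    have e5 : |(δ k)⁻¹ * ((1 + α) * (G (us k) - G u - ⟪A u, us k - u⟫_ℝ))|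
        ≤ |δ k| * (|1 + α| * (C * ‖du k‖ ^ 2)) := by
      rw [abs_mul, abs_mul]
      calc _ ≤ |(δ k)⁻¹| * (|1 + α| * (C * ‖us k - u‖ ^ 2)) := by gcongr; exact hG _ _
        _ = |1 + α| * C * (|(δ k)⁻¹| * ‖δ k • du k‖ ^ 2) := by rw [eu]; ring
        _ = _ := by rw [inv_sq]; ring
    have e6 : |(δ k)⁻¹ * (α * (G (vs k) - G v - ⟪A v, vs k - v⟫_ℝ))|
        ≤ |δ k| * (|α| * (C * ‖dv k‖ ^ 2)) := by
      rw [abs_mul, abs_mul]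
      calc _ ≤ |(δ k)⁻¹| * (|α| * (C * ‖vs k - v‖ ^ 2)) := by gcongr; exact hG _ _
        _ = |α| * C * (|(δ k)⁻¹| * ‖δ k • dv k‖ ^ 2) := by rw [ev]; ring
        _ = _ := by rw [inv_sq]; ring
    have e7 : |(δ k)⁻¹ * (α * lam / 2 * ‖(us k - u) - (vs k - v)‖ ^ 2)|
        ≤ |δ k| * (|α * lam / 2| * ‖du k - dv k‖ ^ 2) := by
      rw [abs_mul, abs_mul, abs_of_nonneg (sq_nonneg ‖_‖), eu, ev, ← smul_sub]
      calc _ = |α * lam / 2| * (|(δ k)⁻¹| * ‖δ k • (du k - dv k)‖ ^ 2) := by ring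
        _ = |δ k| * (|α * lam / 2| * ‖du k - dv k‖ ^ 2) := by rw [inv_sq]; ring
        _ ≤ _ := le_rfl
    -- `A` is only Lipschitz, so this term need not have a limit; it is merely bounded, which makes
    -- the lemma an inequality.
    have e3 : |(δ k)⁻¹ * ⟪A (vs k) - A v, us k - vs k⟫_ℝ|
        ≤ L * ‖dv k‖ * ‖(u - v) + δ k • (du k - dv k)‖ := by
      have h1 : us k - vs k = (u - v) + δ k • (du k - dv k) := by
        rw [smul_sub, ← eu, ← ev]; abel
      rw [abs_mul, ← h1]
      calc _ ≤ |(δ k)⁻¹| * (L * ‖vs k - v‖ * ‖us k - vs k‖) := by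
            gcongr
            exact (abs_real_inner_le_norm _ _).trans (by gcongr; exact hA _ _)
        _ = L * (|(δ k)⁻¹| * ‖δ k • dv k‖) * ‖us k - vs k‖ := by rw [ev]; ring
        _ = _ := by
            rw [norm_smul, Real.norm_eq_abs, abs_inv, inv_mul_cancel_left₀ hpos.ne']
    have e3' : -(α * ((δ k)⁻¹ * ⟪A (vs k) - A v, us k - vs k⟫_ℝ))
        ≤ α * (L * ‖dv k‖ * ‖(u - v) + δ k • (du k - dv k)‖) := by
      rw [← mul_neg]
      exact mul_le_mul_of_nonneg_left ((neg_le_abs _).trans e3) hα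
    have i1 : ∀ x : H, (δ k)⁻¹ * ⟪x, us k - u⟫_ℝ = ⟪x, du k⟫_ℝ := fun x => by
      rw [hdu]; simp only [inner_smul_right]
    have i2 : (δ k)⁻¹ * ⟪u - v, (us k - u) - (vs k - v)⟫_ℝ = ⟪u - v, du k - dv k⟫_ℝ := by
      rw [hdu, hdv]; simp only [← smul_sub, inner_smul_right]
    have i1u := i1 (A u)
    have i1v := i1 (A v)
    rw [lyapunov_sub]
    have f5 := le_abs_self _ |>.trans e5
    have f6 := neg_le_abs _ |>.trans e6
    have f7 := le_abs_self _ |>.trans e7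
    rw [← i1u, ← i1v, ← i2]
    linarith
  refine le_of_tendsto_of_tendsto' hW ?_ bound
  have hd : Tendsto (fun k => (u - v) + δ k • (du k - dv k)) atTop (𝓝 (u - v)) := by
    simpa using (hδ.smul (hu.sub hv)).const_add (u - v)
  have t1 : Tendsto (fun k => (1 + α) * ⟪A u, du k⟫_ℝ - α * ⟪A v, du k⟫_ℝ
      + α * (L * ‖dv k‖ * ‖(u - v) + δ k • (du k - dv k)‖)
      + α * lam * ⟪u - v, du k - dv k⟫_ℝ) atTop
      (𝓝 ((1 + α) * ⟪A u, u'⟫_ℝ - α * ⟪A v, u'⟫_ℝ + α * (L * ‖v'‖ * ‖u - v‖)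
      + α * lam * ⟪u - v, u' - v'⟫_ℝ)) := by
    refine Tendsto.add (Tendsto.add (Tendsto.sub ?_ ?_) ?_) ?_
    · exact (tendsto_const_nhds.inner hu).const_mul _
    · exact (tendsto_const_nhds.inner hu).const_mul _
    · exact ((hv.norm.const_mul L).mul hd.norm).const_mul α
    · exact (tendsto_const_nhds.inner (hu.sub hv)).const_mul _
  have t2 : Tendsto (fun k => |δ k| * (|1 + α| * (C * ‖du k‖ ^ 2) + |α| * (C * ‖dv k‖ ^ 2)
        + |α * lam / 2| * ‖du k - dv k‖ ^ 2)) atTop (𝓝 0) := by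
    have := hδ.abs.mul (((((hu.norm.pow 2).const_mul C).const_mul |1 + α|).add
      (((hv.norm.pow 2).const_mul C).const_mul |α|)).add
      (((hu.sub hv).norm.pow 2).const_mul |α * lam / 2|))
    simpa using this
  simpa using t1.add t2

end Hilbert

/-- The quadratic inequality behind the choice of `lam` and `γ`: here `b = ‖β'‖`, `D = ‖d‖` where
`θ' = γ d`, and `q` is the `L²`-norm of the tracking error. -/
lemma dissipation_le {L Lf LΨ M α lam γ q b D W' : ℝ}
    (hM : 0 < M) (hLΨ : 0 < LΨ) (hα : 0 < α) (hγ0 : 0 < γ)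
    (hq : 0 ≤ q) (hb : 0 ≤ b) (hD : 0 ≤ D) (hL : L < 0 → q = 0)
    (hlam : 2 * LΨ ^ 2 * M * L < lam)
    (hγ : Lf ^ 2 * M * ((α + 1) * L + α * lam) ^ 2 / (2 * α * (lam - 2 * LΨ ^ 2 * M * L)) < γ)
    (hqD : q ^ 2 ≤ 2 * M * D ^ 2) (hDq : D ≤ LΨ * q)
    (hW : W' ≤ -b ^ 2 + ((α + 1) * L + α * lam) * (Lf * b) * q
      + α * (L * (LΨ * (γ * D)) * q) - α * lam * (γ * D ^ 2)) :
    W' ≤ 0 ∧ (¬ (b = 0 ∧ D = 0) → W' < 0) := by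
  set c := (α + 1) * L + α * lam with hc
  set μ := lam - 2 * LΨ ^ 2 * M * L with hμ
  have hμ0 : 0 < μ := by linarith
  have main : ¬ (b = 0 ∧ D = 0) → W' < 0 := by
    intro hne
    rcases hq.eq_or_lt with hq0 | hqpos
    · have hD0 : D = 0 := le_antisymm (by rw [← hq0, mul_zero] at hDq; exact hDq) hD
      have hb0 : 0 < b := lt_of_le_of_ne hb fun h => hne ⟨h.symm, hD0⟩
      rw [← hq0, hD0] at hW
      nlinarith
    · have hL0 : 0 ≤ L := by
        by_contra h
        exact hqpos.ne' (hL (not_le.1 h))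
      -- The cross term in `D * q` is absorbed into `D ^ 2`, which lowers the coefficient `lam` to
      -- `μ`.
      have h1 : LΨ * D * q ≤ 2 * LΨ ^ 2 * M * D ^ 2 := by
        calc LΨ * D * q ≤ LΨ * (LΨ * q) * q := by gcongr
          _ = LΨ ^ 2 * q ^ 2 := by ring
          _ ≤ LΨ ^ 2 * (2 * M * D ^ 2) := by gcongr
          _ = _ := by ring
      have h2 : α * (L * (LΨ * (γ * D)) * q) ≤ α * L * γ * (2 * LΨ ^ 2 * M * D ^ 2) := by
        calc _ = α * L * γ * (LΨ * D * q) := by ring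
          _ ≤ _ := by gcongr
      have hS : W' ≤ -b ^ 2 + (c * Lf * q) * b - α * γ * μ * D ^ 2 := by
        rw [hμ]; nlinarith
      have hDpos : 0 < D ^ 2 := by
        have : 0 < q ^ 2 := by positivity
        by_contra h
        nlinarith
      rw [div_lt_iff₀ (by positivity)] at hγ
      -- The discriminant of the quadratic in `b` is negative; here the lower bound on `γ` enters.
      have h3 : (c * Lf * q) ^ 2 < 4 * (α * γ * μ * D ^ 2) := by
        calc (c * Lf * q) ^ 2 = c ^ 2 * Lf ^ 2 * q ^ 2 := by ring
          _ ≤ c ^ 2 * Lf ^ 2 * (2 * M * D ^ 2) := by gcongr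
          _ = 2 * (Lf ^ 2 * M * c ^ 2) * D ^ 2 := by ring
          _ < 2 * (γ * (2 * α * μ)) * D ^ 2 := by gcongr
          _ = _ := by ring
      nlinarith [sq_nonneg (b - c * Lf * q / 2)]
  refine ⟨?_, main⟩
  by_cases h : b = 0 ∧ D = 0
  · rw [h.1, h.2] at hW
    simpa using hW
  · exact (main h).le

/-! ### Square integrable random vectors -/

section L2

variable {Ω : Type*} [mΩ : MeasurableSpace Ω] {P : Measure Ω}
  {E : Type*} [NormedAddCommGroup E]

open Classical in
/-- The class of `u` in `L²`, and `0` if `u` is not square integrable. -/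
noncomputable def toL2 (P : Measure Ω) (u : Ω → E) : Lp E 2 P :=
  if h : MemLp u 2 P then h.toLp u else 0

lemma toL2_eq {u : Ω → E} (hu : MemLp u 2 P) : toL2 P u = hu.toLp u := dif_pos hu

lemma coeFn_toL2 {u : Ω → E} (hu : MemLp u 2 P) : toL2 P u =ᵐ[P] u := by
  rw [toL2_eq hu]; exact hu.coeFn_toLp

lemma memLp_fun_sub {u v : Ω → E} (hu : MemLp u 2 P) (hv : MemLp v 2 P) :
    MemLp (fun ω => u ω - v ω) 2 P := hu.sub hv

lemma toL2_sub {u v : Ω → E} (hu : MemLp u 2 P) (hv : MemLp v 2 P) :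
    toL2 P (fun ω => u ω - v ω) = toL2 P u - toL2 P v := by
  rw [toL2_eq hu, toL2_eq hv, ← MemLp.toLp_sub hu hv]
  exact toL2_eq (hu.sub hv)

lemma memLp_two_of_integrable_norm_pow_four [IsFiniteMeasure P] {u : Ω → E}
    (hu : AEStronglyMeasurable u P) (h : Integrable (fun ω => ‖u ω‖ ^ 4) P) : MemLp u 2 P := by
  rw [memLp_two_iff_integrable_sq_norm hu]
  refine ((integrable_const (1 : ℝ)).add h).mono' (hu.norm.pow 2) (Eventually.of_forall fun ω => ?_)
  rw [Real.norm_eq_abs, abs_of_nonneg (by positivity), Pi.add_apply]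
  nlinarith [sq_nonneg (‖u ω‖ ^ 2 - 1)]

lemma norm_toL2_le_of_ae {E' : Type*} [NormedAddCommGroup E'] {u : Ω → E} {v : Ω → E'} (hu : MemLp u 2 P) (hv : MemLp v 2 P) {c : ℝ}
    (h : ∀ᵐ ω ∂P, ‖u ω‖ ≤ c * ‖v ω‖) : ‖toL2 P u‖ ≤ c * ‖toL2 P v‖ := by
  apply Lp.norm_le_mul_norm_of_ae_le_mul
  filter_upwards [h, coeFn_toL2 hu, coeFn_toL2 hv] with ω h h1 h2
  rwa [h1, h2]

variable [InnerProductSpace ℝ E]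

lemma toL2_smul {u : Ω → E} (c : ℝ) (hu : MemLp u 2 P) :
    toL2 P (fun ω => c • u ω) = c • toL2 P u := by
  rw [toL2_eq hu, ← MemLp.toLp_const_smul c hu]
  exact toL2_eq (hu.const_smul c)

lemma inner_toL2 {u v : Ω → E} (hu : MemLp u 2 P) (hv : MemLp v 2 P) :
    ⟪toL2 P u, toL2 P v⟫_ℝ = ∫ ω, ⟪u ω, v ω⟫_ℝ ∂P := by
  rw [L2.inner_def]
  refine integral_congr_ae ?_
  filter_upwards [coeFn_toL2 hu, coeFn_toL2 hv] with ω h1 h2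
  rw [h1, h2]

lemma integrable_inner_of_memLp {u v : Ω → E} (hu : MemLp u 2 P) (hv : MemLp v 2 P) :
    Integrable (fun ω => ⟪u ω, v ω⟫_ℝ) P := by
  refine (L2.integrable_inner (𝕜 := ℝ) (toL2 P u) (toL2 P v)).congr ?_
  filter_upwards [coeFn_toL2 hu, coeFn_toL2 hv] with ω h1 h2
  rw [h1, h2]

lemma norm_toL2_sq {u : Ω → E} (hu : MemLp u 2 P) : ‖toL2 P u‖ ^ 2 = ∫ ω, ‖u ω‖ ^ 2 ∂P := by
  rw [← real_inner_self_eq_norm_sq, inner_toL2 hu hu]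
  simp_rw [real_inner_self_eq_norm_sq]

lemma tendsto_toL2 {us : ℕ → Ω → E} {u : Ω → E} {b : Ω → ℝ} (hus : ∀ k, MemLp (us k) 2 P)
    (hu : MemLp u 2 P) (hb : MemLp b 2 P) (hbound : ∀ᶠ k in atTop, ∀ᵐ ω ∂P, ‖us k ω‖ ≤ b ω)
    (hlim : ∀ᵐ ω ∂P, Tendsto (fun k => us k ω) atTop (𝓝 (u ω))) :
    Tendsto (fun k => toL2 P (us k)) atTop (𝓝 (toL2 P u)) := by
  rw [tendsto_iff_norm_sub_tendsto_zero]
  have h0 : Tendsto (fun k => ∫ ω, ‖us k ω - u ω‖ ^ 2 ∂P) atTop (𝓝 (∫ _ω, (0 : ℝ) ∂P)) := by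
    refine tendsto_integral_filter_of_dominated_convergence (fun ω => (b ω + ‖u ω‖) ^ 2)
      (Eventually.of_forall fun k => ?_) ?_ ?_ ?_
    · exact (((hus k).sub hu).1.norm.pow 2)
    · filter_upwards [hbound] with k hk
      filter_upwards [hk] with ω hω
      rw [Real.norm_eq_abs, abs_of_nonneg (by positivity)]
      gcongr
      exact (norm_sub_le _ _).trans (by gcongr)
    · exact (hb.add hu.norm).integrable_sq
    · filter_upwards [hlim] with ω hω
      have := (tendsto_iff_norm_sub_tendsto_zero.1 hω).pow 2
      simpa using this
  have h1 : ∀ k, ‖toL2 P (us k) - toL2 P u‖ = √(∫ ω, ‖us k ω - u ω‖ ^ 2 ∂P) := fun k => by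
    rw [← toL2_sub (hus k) hu, ← norm_toL2_sq (memLp_fun_sub (hus k) hu),
      Real.sqrt_sq (norm_nonneg _)]
  simp_rw [h1]
  simpa using h0.sqrt

lemma memLp_abs_of_integrable_pow_four [IsFiniteMeasure P] {a : Ω → ℝ}
    (h : Integrable (fun ω => a ω ^ 4) P) : MemLp (fun ω => |a ω|) 2 P := by
  -- Only `a ^ 4` is known to be measurable, so `|a|` is recovered from it by square roots.
  have h1 : (fun ω => |a ω|) = fun ω => √(√(a ω ^ 4)) := by
    ext ω
    rw [show a ω ^ 4 = (a ω ^ 2) ^ 2 by ring, Real.sqrt_sq (sq_nonneg _), Real.sqrt_sq_eq_abs]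
  have h2 : AEStronglyMeasurable (fun ω => |a ω|) P := by
    rw [h1]
    exact Real.continuous_sqrt.comp_aestronglyMeasurable
      (Real.continuous_sqrt.comp_aestronglyMeasurable h.1)
  refine memLp_two_of_integrable_norm_pow_four h2 (h.congr (Eventually.of_forall fun ω => ?_))
  simp only [Real.norm_eq_abs, abs_abs]
  exact (Even.pow_abs (by decide) _).symm

/-- (𝔼 a²)² ≤ 𝔼 a⁴, obtained by integrating (a² - c)² ≥ 0 with c = 𝔼 a². -/
lemma norm_toL2_abs_le [IsProbabilityMeasure P] {a : Ω → ℝ} {L : ℝ} (hL : 0 < L)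
    (h : Integrable (fun ω => a ω ^ 4) P) (hle : ∫ ω, a ω ^ 4 ∂P ≤ L ^ 4) :
    ‖toL2 P (fun ω => |a ω|)‖ ≤ L := by
  have hm := memLp_abs_of_integrable_pow_four h
  have h2 : Integrable (fun ω => |a ω| ^ 2) P := hm.integrable_sq
  set c := ∫ ω, |a ω| ^ 2 ∂P with hc
  have hn : ‖toL2 P (fun ω => |a ω|)‖ ^ 2 = c := by
    rw [norm_toL2_sq hm]; simp only [Real.norm_eq_abs, abs_abs, hc]
  have hJ : 0 ≤ ∫ ω, (a ω ^ 4 - 2 * c * |a ω| ^ 2 + c ^ 2) ∂P := by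
    refine integral_nonneg fun ω => ?_
    have : a ω ^ 4 = (|a ω| ^ 2) ^ 2 := by rw [sq_abs]; ring
    simp only [Pi.zero_apply]
    rw [this]
    nlinarith [sq_nonneg (|a ω| ^ 2 - c)]
  have h3 : Integrable (fun ω => 2 * c * |a ω| ^ 2) P := h2.const_mul _
  have h5 : Integrable (fun ω => a ω ^ 4 - 2 * c * |a ω| ^ 2) P := h.sub h3
  rw [integral_add h5 (integrable_const _), integral_sub h h3, integral_const_mul, ← hc] at hJ
  simp only [integral_const, probReal_univ, smul_eq_mul, one_mul] at hJ
  have h4 : ‖toL2 P (fun ω => |a ω|)‖ ^ 4 ≤ L ^ 4 := by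
    rw [show ‖toL2 P (fun ω => |a ω|)‖ ^ 4 = (‖toL2 P (fun ω => |a ω|)‖ ^ 2) ^ 2 by ring, hn]
    linarith
  exact le_of_pow_le_pow_left₀ (by norm_num) hL.le h4

end L2

/-! ### Conditional expectation on `L²` -/

section CondL2

variable {Ω : Type*} {m mΩ : MeasurableSpace Ω} {P : Measure Ω}
  {E : Type*} [NormedAddCommGroup E] [InnerProductSpace ℝ E] [CompleteSpace E]

variable (P E) in
/-- Conditional expectation as an operator on `L²`. -/
noncomputable def condL2 (hm : m ≤ mΩ) : Lp E 2 P →L[ℝ] Lp E 2 P :=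
  (lpMeas E ℝ m 2 P).subtypeL.comp (condExpL2 E ℝ hm)

lemma norm_condL2_le (hm : m ≤ mΩ) (u : Lp E 2 P) : ‖condL2 P E hm u‖ ≤ ‖u‖ :=
  norm_condExpL2_le hm u

lemma toL2_condExp [IsFiniteMeasure P] (hm : m ≤ mΩ) {u : Ω → E} (hu : MemLp u 2 P) :
    toL2 P (P[u|m]) = condL2 P E hm (toL2 P u) := by
  have h1 : MemLp (P[u|m]) 2 P := hu.condExp one_le_two
  apply Lp.ext
  refine (coeFn_toL2 h1).trans ?_
  rw [toL2_eq hu]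
  exact (hu.condExpL2_ae_eq_condExp (𝕜 := ℝ) hm).symm

end CondL2

/-! ### Random generalized Jacobians -/

/-- The random function `h (ζ ω)` has generalized Jacobians `D (ζ ω)`, bounded on the convex set
`K` by the square integrable `a (ζ ω)`, and its values on `K` are square integrable. -/
structure IsRandomGenJacobian {Ω S : Type*} [MeasurableSpace Ω] [MeasurableSpace S] {n m : ℕ}
    (P : Measure Ω) (ζ : Ω → S) (h : S → Vec n → Vec m) (D : S → Vec n → Set (Jac m n))
    (K : Set (Vec n)) (a : S → ℝ) : Prop where
  genJacobian : ∀ s, IsGenJacobian (h s) (D s)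
  convex : Convex ℝ K
  bound : ∀ x ∈ K, ∀ s, ∀ J ∈ D s x, ‖J‖ ≤ a s
  bound_memLp : MemLp (fun ω => a (ζ ω)) 2 P
  memLp : ∀ x ∈ K, MemLp (fun ω => h (ζ ω) x) 2 P

namespace IsRandomGenJacobian

variable {Ω S : Type*} [MeasurableSpace Ω] [MeasurableSpace S] {n m : ℕ}
  {P : Measure Ω} {ζ : Ω → S} {h : S → Vec n → Vec m} {D : S → Vec n → Set (Jac m n)}
  {K : Set (Vec n)} {a : S → ℝ}

lemma norm_toL2_sub_le (hD : IsRandomGenJacobian P ζ h D K a) {x y : Vec n}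
    (hx : x ∈ K) (hy : y ∈ K) :
    ‖toL2 P (fun ω => h (ζ ω) y) - toL2 P (fun ω => h (ζ ω) x)‖
      ≤ ‖toL2 P (fun ω => a (ζ ω))‖ * ‖y - x‖ := by
  rw [← toL2_sub (hD.memLp y hy) (hD.memLp x hx), mul_comm]
  refine norm_toL2_le_of_ae ((hD.memLp y hy).sub (hD.memLp x hx)) hD.bound_memLp
    (Eventually.of_forall fun ω => ?_)
  rw [mul_comm]
  refine ((hD.genJacobian (ζ ω)).norm_sub_le hD.convex
    (fun z hz => hD.bound z hz (ζ ω)) hx hy).trans ?_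
  gcongr
  exact Real.le_norm_self _

lemma memLp_selection (hD : IsRandomGenJacobian P ζ h D K a) (hζ : Measurable ζ) {x : Vec n}
    (hx : x ∈ K) {σ : S → Jac m n} (hσ : Measurable σ) (hσD : ∀ᵐ ω ∂P, σ (ζ ω) ∈ D (ζ ω) x) :
    MemLp (fun ω => σ (ζ ω)) 2 P := by
  refine hD.bound_memLp.mono (hσ.comp hζ).aestronglyMeasurable ?_
  filter_upwards [hσD] with ω hω
  exact (hD.bound x hx _ _ hω).trans (Real.le_norm_self _)

lemma memLp_adjoint {J : Ω → Jac m n} (hJ : MemLp J 2 P) (v : Vec n) :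
    MemLp (fun ω => ContinuousLinearMap.adjoint (J ω) v) 2 P := by
  have hc : Continuous fun T : Jac m n => ContinuousLinearMap.adjoint T v :=
    (ContinuousLinearMap.apply ℝ (Vec m) v).continuous.comp ContinuousLinearMap.adjoint.continuous
  refine (hJ.norm.const_mul ‖v‖).mono (hc.comp_aestronglyMeasurable hJ.1)
    (Eventually.of_forall fun ω => ?_)
  rw [norm_mul, norm_norm, norm_norm, mul_comm]
  exact norm_adjoint_apply_le _ _

lemma norm_toL2_adjoint_le (hD : IsRandomGenJacobian P ζ h D K a) (hζ : Measurable ζ) {x : Vec n}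
    (hx : x ∈ K) {σ : S → Jac m n} (hσ : Measurable σ) (hσD : ∀ᵐ ω ∂P, σ (ζ ω) ∈ D (ζ ω) x)
    (v : Vec n) :
    ‖toL2 P (fun ω => ContinuousLinearMap.adjoint (σ (ζ ω)) v)‖
      ≤ ‖toL2 P (fun ω => a (ζ ω))‖ * ‖v‖ := by
  rw [mul_comm]
  refine norm_toL2_le_of_ae (memLp_adjoint (hD.memLp_selection hζ hx hσ hσD) v) hD.bound_memLp ?_
  filter_upwards [hσD] with ω hω
  rw [mul_comm]
  refine (norm_adjoint_apply_le _ _).trans ?_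
  gcongr
  exact (hD.bound x hx _ _ hω).trans (Real.le_norm_self _)

/-- Chain rule in L²: the quotients converge almost surely by the deterministic lemma, and the mean
value inequality on `K` dominates them by a multiple of `a`. -/
lemma tendsto_slope (hD : IsRandomGenJacobian P ζ h D K a) (hζ : Measurable ζ) {x v : Vec n}
    (hx : x ∈ K) {xs : ℕ → Vec n} (hxsK : ∀ k, xs k ∈ K) {δ : ℕ → ℝ}
    (hxs : Tendsto xs atTop (𝓝 x))
    (hv : Tendsto (fun k => (δ k)⁻¹ • (xs k - x)) atTop (𝓝 v))
    {σ : S → Jac m n} {σs : ℕ → S → Jac m n} (hσm : Measurable σ)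
    (hσD : ∀ᵐ ω ∂P, σ (ζ ω) ∈ D (ζ ω) x) (hσs : ∀ k, ∀ᵐ ω ∂P, σs k (ζ ω) ∈ D (ζ ω) (xs k))
    (hσ : ∀ᵐ ω ∂P, Tendsto (fun k => σs k (ζ ω)) atTop (𝓝 (σ (ζ ω)))) :
    Tendsto (fun k => (δ k)⁻¹ • (toL2 P (fun ω => h (ζ ω) (xs k)) - toL2 P (fun ω => h (ζ ω) x)))
      atTop (𝓝 (toL2 P fun ω => ContinuousLinearMap.adjoint (σ (ζ ω)) v)) := by
  have hmem : ∀ k, MemLp (fun ω => h (ζ ω) (xs k) - h (ζ ω) x) 2 P := fun k =>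
    (hD.memLp _ (hxsK k)).sub (hD.memLp x hx)
  have heq : ∀ k, (δ k)⁻¹ • (toL2 P (fun ω => h (ζ ω) (xs k)) - toL2 P (fun ω => h (ζ ω) x))
      = toL2 P (fun ω => (δ k)⁻¹ • (h (ζ ω) (xs k) - h (ζ ω) x)) := fun k => by
    rw [toL2_smul _ (hmem k), toL2_sub (hD.memLp _ (hxsK k)) (hD.memLp x hx)]
  simp_rw [heq]
  refine tendsto_toL2 (b := fun ω => (‖v‖ + 1) * ‖a (ζ ω)‖) (fun k => (hmem k).const_smul (δ k)⁻¹)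
    (memLp_adjoint (hD.memLp_selection hζ hx hσm hσD) v) (hD.bound_memLp.norm.const_mul _) ?_ ?_
  · filter_upwards [hv.norm.eventually (gt_mem_nhds (lt_add_one ‖v‖))] with k hk
    refine Eventually.of_forall fun ω => ?_
    have h1 := (hD.genJacobian (ζ ω)).norm_sub_le hD.convex
      (fun z hz => hD.bound z hz (ζ ω)) hx (hxsK k)
    rw [norm_smul] at hk ⊢
    calc ‖(δ k)⁻¹‖ * ‖h (ζ ω) (xs k) - h (ζ ω) x‖
        ≤ ‖(δ k)⁻¹‖ * (‖a (ζ ω)‖ * ‖xs k - x‖) := by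
          gcongr
          exact h1.trans (by gcongr; exact Real.le_norm_self _)
      _ = ‖(δ k)⁻¹‖ * ‖xs k - x‖ * ‖a (ζ ω)‖ := by ring
      _ ≤ _ := by gcongr
  · filter_upwards [hσ, ae_all_iff.2 hσs] with ω h1 h2
    exact (hD.genJacobian (ζ ω)).tendsto_slope hxs hv h2 h1

end IsRandomGenJacobian

/-! ### The outer function on `L²` -/

section Outer

variable {Ω : Type*} [MeasurableSpace Ω] {P : Measure Ω} {m : ℕ}

/-- The gradient field of `g` acting on random vectors. -/
noncomputable def gradL2 (P : Measure Ω) (g : Vec m → ℝ) (u : Lp (Vec m) 2 P) : Lp (Vec m) 2 P :=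
  toL2 P fun ω => gradient g (u ω)

variable {g : Vec m → ℝ} {L Lg : ℝ}

lemma continuous_gradient_of_lipschitz
    (hL : ∀ u v, ‖gradient g u - gradient g v‖ ≤ L * ‖u - v‖) : Continuous (gradient g) := by
  refine (LipschitzWith.of_dist_le_mul (K := |L|.toNNReal) fun u v => ?_).continuous
  rw [dist_eq_norm, dist_eq_norm, Real.coe_toNNReal _ (abs_nonneg L)]
  exact (hL u v).trans (by gcongr; exact le_abs_self L)

lemma hasFDerivAt_inner_gradient (hg : ContDiff ℝ 1 g) (u : Vec m) :
    HasFDerivAt g (innerSL ℝ (gradient g u)) u := by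
  have h1 := ((hg.differentiable one_ne_zero) u).hasGradientAt
  exact h1.hasFDerivAt

/-- Mean value inequality for `g` minus its linearization at `u`. The constant is not sharp; only
the quadratic order matters. -/
lemma abs_sub_inner_gradient_le (hg : ContDiff ℝ 1 g)
    (hL : ∀ u v, ‖gradient g u - gradient g v‖ ≤ L * ‖u - v‖) (u v : Vec m) :
    |g v - g u - ⟪gradient g u, v - u⟫_ℝ| ≤ |L| * ‖v - u‖ ^ 2 := by
  have := (convex_segment u v).norm_image_sub_le_of_norm_hasFDerivWithin_le'
    (f := g) (f' := fun x => innerSL ℝ (gradient g x)) (φ := innerSL ℝ (gradient g u))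
    (C := |L| * ‖v - u‖) (fun x _ => (hasFDerivAt_inner_gradient hg x).hasFDerivWithinAt) ?_
    (left_mem_segment ℝ u v) (right_mem_segment ℝ u v)
  · rw [Real.norm_eq_abs, innerSL_apply_apply] at this
    refine this.trans (le_of_eq ?_)
    ring
  · intro x hx
    rw [← map_sub, innerSL_apply_norm]
    refine (hL x u).trans ?_
    have h1 : ‖x - u‖ ≤ ‖v - u‖ := by
      have := norm_sub_le_of_mem_segment hx
      simpa using this
    calc L * ‖x - u‖ ≤ |L| * ‖x - u‖ := by gcongr; exact le_abs_self L
      _ ≤ _ := by gcongr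

lemma abs_le_of_gradient_bound (hg : ContDiff ℝ 1 g) (hb : ∀ u, ‖gradient g u‖ ≤ Lg)
    (u : Vec m) : |g u| ≤ |g 0| + Lg * ‖u‖ := by
  have := convex_univ.norm_image_sub_le_of_norm_hasFDerivWithin_le
    (f := g) (f' := fun x => innerSL ℝ (gradient g x)) (C := Lg) (x := 0) (y := u)
    (fun x _ => (hasFDerivAt_inner_gradient hg x).hasFDerivWithinAt)
    (fun x _ => by rw [innerSL_apply_norm]; exact hb x) (mem_univ _) (mem_univ _)
  rw [sub_zero, Real.norm_eq_abs] at this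
  have h2 := abs_sub_abs_le_abs_sub (g u) (g 0)
  linarith

lemma toL2_coeFn (u : Lp (Vec m) 2 P) : toL2 P (fun ω => u ω) = u := by
  rw [toL2_eq (Lp.memLp u)]; exact Lp.toLp_coeFn u _

lemma norm_sub_sq_eq_integral (v w : Lp (Vec m) 2 P) :
    ‖v - w‖ ^ 2 = ∫ ω, ‖v ω - w ω‖ ^ 2 ∂P := by
  rw [← norm_toL2_sq (memLp_fun_sub (Lp.memLp v) (Lp.memLp w))]
  congr 2
  have := toL2_sub (Lp.memLp v) (Lp.memLp w)
  rw [toL2_coeFn v, toL2_coeFn w] at this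
  exact this.symm

lemma integrable_norm_sub_sq (v w : Lp (Vec m) 2 P) :
    Integrable (fun ω => ‖v ω - w ω‖ ^ 2) P :=
  (memLp_two_iff_integrable_sq_norm ((Lp.memLp v).sub (Lp.memLp w)).1).1
    ((Lp.memLp v).sub (Lp.memLp w))

variable [IsProbabilityMeasure P]

lemma integrable_comp (hg : ContDiff ℝ 1 g) (hb : ∀ u, ‖gradient g u‖ ≤ Lg)
    {u : Ω → Vec m} (hu : MemLp u 2 P) : Integrable (fun ω => g (u ω)) P := by
  have h1 : Integrable (fun ω => ‖u ω‖) P := (hu.integrable one_le_two).norm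
  refine ((integrable_const |g 0|).add (h1.const_mul Lg)).mono'
    (hg.continuous.comp_aestronglyMeasurable hu.1) (Eventually.of_forall fun ω => ?_)
  exact abs_le_of_gradient_bound hg hb _

lemma memLp_gradient (hL : ∀ u v, ‖gradient g u - gradient g v‖ ≤ L * ‖u - v‖)
    (hb : ∀ u, ‖gradient g u‖ ≤ Lg) {u : Ω → Vec m} (hu : AEStronglyMeasurable u P) :
    MemLp (fun ω => gradient g (u ω)) 2 P :=
  MemLp.of_bound ((continuous_gradient_of_lipschitz hL).comp_aestronglyMeasurable hu) Lg
    (Eventually.of_forall fun _ => hb _)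

lemma inner_gradL2 (hL : ∀ u v, ‖gradient g u - gradient g v‖ ≤ L * ‖u - v‖)
    (hb : ∀ u, ‖gradient g u‖ ≤ Lg) (u : Lp (Vec m) 2 P) {x : Ω → Vec m} (hx : MemLp x 2 P) :
    ⟪gradL2 P g u, toL2 P x⟫_ℝ = ∫ ω, ⟪gradient g (u ω), x ω⟫_ℝ ∂P :=
  inner_toL2 (memLp_gradient hL hb (Lp.memLp u).1) hx

lemma inner_gradL2_sub (hL : ∀ u v, ‖gradient g u - gradient g v‖ ≤ L * ‖u - v‖)
    (hb : ∀ u, ‖gradient g u‖ ≤ Lg) (u v w : Lp (Vec m) 2 P) :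
    ⟪gradL2 P g u, v - w⟫_ℝ = ∫ ω, ⟪gradient g (u ω), v ω - w ω⟫_ℝ ∂P := by
  rw [← inner_gradL2 hL hb u (memLp_fun_sub (Lp.memLp v) (Lp.memLp w))]
  congr 1
  have := toL2_sub (Lp.memLp v) (Lp.memLp w)
  rw [toL2_coeFn v, toL2_coeFn w] at this
  exact this.symm

lemma integrable_inner_gradient (hL : ∀ u v, ‖gradient g u - gradient g v‖ ≤ L * ‖u - v‖)
    (hb : ∀ u, ‖gradient g u‖ ≤ Lg) (u v w : Lp (Vec m) 2 P) :
    Integrable (fun ω => ⟪gradient g (u ω), v ω - w ω⟫_ℝ) P :=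
  integrable_inner_of_memLp (memLp_gradient hL hb (Lp.memLp u).1)
    (memLp_fun_sub (Lp.memLp v) (Lp.memLp w))

/-- The pointwise quadratic remainder integrates, so `gradL2` is the gradient of u ↦ 𝔼 g(u) on L².
-/
lemma abs_integral_sub_inner_gradL2_le (hg : ContDiff ℝ 1 g)
    (hL : ∀ u v, ‖gradient g u - gradient g v‖ ≤ L * ‖u - v‖)
    (hb : ∀ u, ‖gradient g u‖ ≤ Lg) (u v : Lp (Vec m) 2 P) :
    |∫ ω, g (v ω) ∂P - ∫ ω, g (u ω) ∂P - ⟪gradL2 P g u, v - u⟫_ℝ| ≤ |L| * ‖v - u‖ ^ 2 := by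
  have iu := integrable_comp hg hb (Lp.memLp u)
  have iv := integrable_comp hg hb (Lp.memLp v)
  have ivu : Integrable (fun ω => g (v ω) - g (u ω)) P := iv.sub iu
  rw [inner_gradL2_sub hL hb, ← integral_sub iv iu,
    ← integral_sub ivu (integrable_inner_gradient hL hb u v u),
    norm_sub_sq_eq_integral, ← integral_const_mul]
  rw [← Real.norm_eq_abs]
  refine norm_integral_le_of_norm_le ((integrable_norm_sub_sq v u).const_mul _)
    (Eventually.of_forall fun ω => ?_)
  rw [Real.norm_eq_abs]
  exact abs_sub_inner_gradient_le hg hL _ _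

lemma norm_gradL2_sub_le (hL : ∀ u v, ‖gradient g u - gradient g v‖ ≤ L * ‖u - v‖)
    (hb : ∀ u, ‖gradient g u‖ ≤ Lg) (u v : Lp (Vec m) 2 P) :
    ‖gradL2 P g u - gradL2 P g v‖ ≤ L * ‖u - v‖ := by
  have hu := memLp_gradient hL hb (Lp.memLp u).1
  have hv := memLp_gradient hL hb (Lp.memLp v).1
  unfold gradL2
  rw [← toL2_sub hu hv]
  have := toL2_sub (Lp.memLp u) (Lp.memLp v)
  rw [toL2_coeFn u, toL2_coeFn v] at this
  rw [← this]
  exact norm_toL2_le_of_ae (hu.sub hv) ((Lp.memLp u).sub (Lp.memLp v))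
    (Eventually.of_forall fun ω => hL _ _)

/-- The regularized Bregman distance of random vectors is the one of their `L²` classes. -/
lemma integral_bregman_eq (hg : ContDiff ℝ 1 g)
    (hL : ∀ u v, ‖gradient g u - gradient g v‖ ≤ L * ‖u - v‖)
    (hb : ∀ u, ‖gradient g u‖ ≤ Lg) (lam : ℝ) {u v : Ω → Vec m}
    (hu : MemLp u 2 P) (hv : MemLp v 2 P) :
    ∫ ω, (g (u ω) - g (v ω) - ⟪gradient g (v ω), u ω - v ω⟫_ℝ + lam / 2 * ‖u ω - v ω‖ ^ 2) ∂P
      = ∫ ω, g (toL2 P u ω) ∂P - ∫ ω, g (toL2 P v ω) ∂P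
        - ⟪gradL2 P g (toL2 P v), toL2 P u - toL2 P v⟫_ℝ
        + lam / 2 * ‖toL2 P u - toL2 P v‖ ^ 2 := by
  set U := toL2 P u
  set V := toL2 P v
  have iU := integrable_comp hg hb (Lp.memLp U)
  have iV := integrable_comp hg hb (Lp.memLp V)
  have iI := integrable_inner_gradient hL hb V U V
  have iN := (integrable_norm_sub_sq U V).const_mul (lam / 2)
  have iD : Integrable (fun ω => g (U ω) - g (V ω)) P := iU.sub iV
  have iE : Integrable (fun ω => g (U ω) - g (V ω) - ⟪gradient g (V ω), U ω - V ω⟫_ℝ) P :=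
    iD.sub iI
  rw [inner_gradL2_sub hL hb, norm_sub_sq_eq_integral, ← integral_const_mul, ← integral_sub iU iV,
    ← integral_sub iD iI, ← integral_add iE iN]
  refine integral_congr_ae ?_
  filter_upwards [coeFn_toL2 hu, coeFn_toL2 hv] with ω h1 h2
  simp only [U, V, h1, h2]

end Outer

/-! ### Approximating selections along a sequence of times -/

/-- For all but countably many times `t ∈ T`, the random vectors `σ t` and `τ t` are almost sure
limits of `σ (ts k)` and `τ (ts k)` along a sequence of other times `ts k → t` in `T`. -/
lemma exists_seq_tendsto_selections {Ω S₁ S₂ E₁ E₂ : Type*} [MeasurableSpace Ω]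
    [MeasurableSpace S₁] [MeasurableSpace.CountablyGenerated S₁]
    [MeasurableSpace S₂] [MeasurableSpace.CountablyGenerated S₂]
    [NormedAddCommGroup E₁] [TopologicalSpace.SeparableSpace E₁]
    [NormedAddCommGroup E₂] [TopologicalSpace.SeparableSpace E₂]
    {P : Measure Ω} [IsFiniteMeasure P] {ζ₁ : Ω → S₁} {ζ₂ : Ω → S₂}
    (hζ₁ : Measurable ζ₁) (hζ₂ : Measurable ζ₂) (T : Set ℝ) (σ : ℝ → S₁ → E₁) (τ : ℝ → S₂ → E₂)
    (hσ : ∀ t ∈ T, MemLp (σ t) 2 (P.map ζ₁)) (hτ : ∀ t ∈ T, MemLp (τ t) 2 (P.map ζ₂)) :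
    ∃ N : Set ℝ, N.Countable ∧ ∀ t ∈ T, t ∉ N → ∃ ts : ℕ → ℝ,
      (∀ k, ts k ∈ T ∧ ts k ≠ t) ∧ Tendsto ts atTop (𝓝 t) ∧
      (∀ᵐ ω ∂P, Tendsto (fun k => σ (ts k) (ζ₁ ω)) atTop (𝓝 (σ t (ζ₁ ω)))) ∧
      (∀ᵐ ω ∂P, Tendsto (fun k => τ (ts k) (ζ₂ ω)) atTop (𝓝 (τ t (ζ₂ ω)))) := by
  have : Fact ((2 : ENNReal) ≠ ⊤) := ⟨by simp⟩
  -- Working over the laws of `ζ₁` and `ζ₂` makes the L² spaces separable although `Ω` is arbitrary.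
  -- The first coordinate forces `ts` to converge to `t`.
  set e : ℝ → ℝ × Lp E₁ 2 (P.map ζ₁) × Lp E₂ 2 (P.map ζ₂) := fun t =>
    (t, toL2 _ (σ t), toL2 _ (τ t)) with he
  refine ⟨_, countable_setOf_notMem_closure_image e T, fun t htT ht => ?_⟩
  have hcl : e t ∈ closure (e '' (T \ {t})) := by
    by_contra h
    exact ht ⟨htT, h⟩
  obtain ⟨x, hx, hxlim⟩ := mem_closure_iff_seq_limit.1 hcl
  choose ts htsT htsx using hx
  have hlim : Tendsto (fun k => e (ts k)) atTop (𝓝 (e t)) := by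
    simpa only [htsx] using hxlim
  have h1 : Tendsto ts atTop (𝓝 t) := (continuous_fst.tendsto (e t)).comp hlim
  have h2 : Tendsto (fun k => toL2 (P.map ζ₁) (σ (ts k))) atTop (𝓝 (toL2 _ (σ t))) :=
    ((continuous_fst.comp continuous_snd).tendsto (e t)).comp hlim
  have h3 : Tendsto (fun k => toL2 (P.map ζ₂) (τ (ts k))) atTop (𝓝 (toL2 _ (τ t))) :=
    ((continuous_snd.comp continuous_snd).tendsto (e t)).comp hlim
  obtain ⟨ns, hns, hσlim⟩ := (tendstoInMeasure_of_tendsto_Lp h2).exists_seq_tendsto_ae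
  obtain ⟨ms, hms, hτlim⟩ := (tendstoInMeasure_of_tendsto_Lp
    (h3.comp hns.tendsto_atTop)).exists_seq_tendsto_ae
  refine ⟨fun k => ts (ns (ms k)), fun k => ⟨(htsT _).1, (htsT _).2⟩,
    h1.comp (hns.tendsto_atTop.comp hms.tendsto_atTop), ?_, ?_⟩
  · refine ae_of_ae_map hζ₁.aemeasurable (p := fun s =>
      Tendsto (fun k => σ (ts (ns (ms k))) s) atTop (𝓝 (σ t s))) ?_
    filter_upwards [hσlim, coeFn_toL2 (hσ t htT),
      ae_all_iff.2 fun k => coeFn_toL2 (hσ (ts k) (htsT k).1)] with s h1 h2 h3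
    rw [h2] at h1
    simp only [h3] at h1
    exact h1.comp hms.tendsto_atTop
  · refine ae_of_ae_map hζ₂.aemeasurable (p := fun s =>
      Tendsto (fun k => τ (ts (ns (ms k))) s) atTop (𝓝 (τ t s))) ?_
    filter_upwards [hτlim, coeFn_toL2 (hτ t htT),
      ae_all_iff.2 fun k => coeFn_toL2 (hτ (ts k) (htsT k).1)] with s h1 h2 h3
    rw [h2] at h1
    simpa only [Function.comp_apply, h3] using h1

/-! ### Paths in convex sets -/

/-- Fermat's rule: the pairing with `v` has a local maximum at `t`. With `v` normal to a convex set
containing the path, the velocity is orthogonal to `v`. -/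
lemma inner_deriv_eq_zero_of_eventually_le {E : Type*} [NormedAddCommGroup E]
    [InnerProductSpace ℝ E] {q : ℝ → E} {q' v : E} {t : ℝ} (hq : HasDerivAt q q' t)
    (hv : ∀ᶠ s in 𝓝 t, ⟪v, q s - q t⟫_ℝ ≤ 0) : ⟪v, q'⟫_ℝ = 0 := by
  have hd : HasDerivAt (fun s => ⟪v, q s - q t⟫_ℝ) ⟪v, q'⟫_ℝ t := by
    simpa using (hasDerivAt_const t v).inner ℝ (hq.sub_const (q t))
  refine IsLocalMax.hasDerivAt_eq_zero ?_ hd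
  filter_upwards [hv] with s hs
  simpa using hs

/-- If `q t` were outside the closed set, so would be `q` on a whole interval to the right of `t`,
which has positive measure. -/
lemma forall_mem_of_ae_mem {E : Type*} [TopologicalSpace E] {q : ℝ → E} {K : Set E}
    (hK : IsClosed K) (hq : ContinuousOn q (Ici 0))
    (h : ∀ᵐ t ∂(volume.restrict (Ici (0 : ℝ))), q t ∈ K) {t : ℝ} (ht : 0 ≤ t) : q t ∈ K := by
  have hlim : Tendsto q (𝓝[>] t) (𝓝 (q t)) :=
    (hq t ht).mono_left (nhdsWithin_mono _ fun s hs => ht.trans (le_of_lt hs))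
  by_contra hne
  have hev : ∀ᶠ s in 𝓝[>] t, q s ∉ K := hlim.eventually (hK.isOpen_compl.mem_nhds hne)
  obtain ⟨b, hb, hbad⟩ := (mem_nhdsGT_iff_exists_Ioo_subset).1 hev
  rw [ae_restrict_iff' measurableSet_Ici] at h
  have h0 : volume (Ioo t b) = 0 := by
    refine measure_mono_null (fun s hs => ?_) h
    simp only [mem_compl_iff, mem_ofPred_eq, not_forall]
    exact ⟨ht.trans hs.1.le, hbad hs⟩
  rw [Real.volume_Ioo, ENNReal.ofReal_eq_zero] at h0
  have : t < b := hb
  linarith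

/-! ### Square integrability from the moment assumptions. -/

namespace Problem

variable {Ω : Type*} [mΩ : MeasurableSpace Ω] {nX nY nβ nf nθ : ℕ}
  {p : Problem Ω nX nY nβ nf nθ}

lemma sigmaX_le (p : Problem Ω nX nY nβ nf nθ) : p.sigmaX ≤ mΩ :=
  p.measurable_X.comap_le

lemma measurable_XY (p : Problem Ω nX nY nβ nf nθ) : Measurable fun ω => (p.X ω, p.Y ω) :=
  p.measurable_X.prodMk p.measurable_Y

lemma A3.exists_isRandomGenJacobian {Lf : ℝ} (h3 : p.A3 Lf) (h1 : p.A1) :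
    ∃ a : Vec nX × Vec nY → ℝ,
      IsRandomGenJacobian p.P (fun ω => (p.X ω, p.Y ω)) (fun s => p.f s.1 s.2)
        (fun s => p.subdiff_f s.1 s.2) p.B a ∧
      ‖toL2 p.P (fun ω => a (p.X ω, p.Y ω))‖ ≤ Lf := by
  have := p.isProb
  obtain ⟨ℓ, hℓ, hint, hle⟩ := h3.subgrad
  obtain ⟨C, -, hC⟩ := h3.moment
  refine ⟨fun s => |ℓ s.1 s.2|, ⟨fun s => h3.genDiff s.1 s.2, h1.convex,
    fun β hβ s J hJ => (hℓ β hβ s.1 s.2 J hJ).trans (le_abs_self _),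
    memLp_abs_of_integrable_pow_four hint, fun β hβ => ?_⟩, norm_toL2_abs_le h3.pos hint hle⟩
  exact memLp_two_of_integrable_norm_pow_four
    ((p.measurable_f β).comp p.measurable_XY).aestronglyMeasurable (hC β hβ).1

lemma A4.exists_isRandomGenJacobian {LΨ : ℝ} (h4 : p.A4 LΨ) :
    ∃ a : Vec nX → ℝ,
      IsRandomGenJacobian p.P p.X p.Ψ p.subdiff_Ψ univ a ∧
      ‖toL2 p.P (fun ω => a (p.X ω))‖ ≤ LΨ := by
  have := p.isProb
  obtain ⟨ℓ, hℓ, hint, hle⟩ := h4.subgrad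
  obtain ⟨C, -, θ₀, hC, -⟩ := h4.moment
  have hb : ∀ θ ∈ (univ : Set (Vec nθ)), ∀ x, ∀ J ∈ p.subdiff_Ψ x θ, ‖J‖ ≤ |ℓ x| :=
    fun θ _ x J hJ => (hℓ x θ J hJ).trans (le_abs_self _)
  have hm := memLp_abs_of_integrable_pow_four hint
  have hmeas : ∀ θ, AEStronglyMeasurable (fun ω => p.Ψ (p.X ω) θ) p.P := fun θ =>
    ((p.measurable_Ψ θ).comp p.measurable_X).aestronglyMeasurable
  have h0 : MemLp (fun ω => p.Ψ (p.X ω) θ₀) 2 p.P :=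
    memLp_two_of_integrable_norm_pow_four (hmeas θ₀) hC
  refine ⟨fun x => |ℓ x|, ⟨h4.genDiff, convex_univ, hb, hm, fun θ _ => ?_⟩,
    norm_toL2_abs_le h4.pos hint hle⟩
  -- The moment is assumed at `θ₀` only; the mean value inequality transfers it to every `θ`.
  have h1 : MemLp (fun ω => p.Ψ (p.X ω) θ - p.Ψ (p.X ω) θ₀) 2 p.P := by
    refine (hm.const_mul ‖θ - θ₀‖).mono ((hmeas θ).sub (hmeas θ₀)) (Eventually.of_forall fun ω => ?_)
    rw [norm_mul, norm_norm, Real.norm_eq_abs, abs_abs, mul_comm]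
    exact (h4.genDiff (p.X ω)).norm_sub_le convex_univ (fun z hz => hb z hz (p.X ω))
      (mem_univ _) (mem_univ _)
  have h2 := h1.add h0
  refine h2.ae_eq (Eventually.of_forall fun ω => ?_)
  simp

/-! ### The problem in `L²` -/

/-- `f(X, Y, β)` in `L²`. -/
noncomputable def fL2 (p : Problem Ω nX nY nβ nf nθ) (β : Vec nβ) : Lp (Vec nf) 2 p.P :=
  toL2 p.P fun ω => p.f (p.X ω) (p.Y ω) β

/-- `F(X, β)` in `L²`. -/
noncomputable def FL2 (p : Problem Ω nX nY nβ nf nθ) (β : Vec nβ) : Lp (Vec nf) 2 p.P :=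
  toL2 p.P (p.F β)

/-- `Ψ(X, θ)` in `L²`. -/
noncomputable def ΨL2 (p : Problem Ω nX nY nβ nf nθ) (θ : Vec nθ) : Lp (Vec nf) 2 p.P :=
  toL2 p.P fun ω => p.Ψ (p.X ω) θ

lemma memLp_F (p : Problem Ω nX nY nβ nf nθ) {β : Vec nβ}
    (h : MemLp (fun ω => p.f (p.X ω) (p.Y ω) β) 2 p.P) : MemLp (p.F β) 2 p.P :=
  h.condExp one_le_two

/-- Conditional expectation is a linear contraction of L², so Lipschitz bounds and limits of
difference quotients pass from f to F. -/
lemma FL2_eq (p : Problem Ω nX nY nβ nf nθ) {β : Vec nβ}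
    (h : MemLp (fun ω => p.f (p.X ω) (p.Y ω) β) 2 p.P) :
    p.FL2 β = condL2 p.P (Vec nf) p.sigmaX_le (p.fL2 β) := by
  have := p.isProb
  exact toL2_condExp p.sigmaX_le h

lemma w_eq_lyapunov {Lg : ℝ} (h2 : p.A2 Lg) (α lam : ℝ) {z : Pair nβ nθ}
    (hF : MemLp (p.F z.fst) 2 p.P) (hΨ : MemLp (fun ω => p.Ψ (p.X ω) z.snd) 2 p.P) :
    p.w α lam z = lyapunov (fun u : Lp (Vec nf) 2 p.P => ∫ ω, p.g (u ω) ∂p.P) (gradL2 p.P p.g)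
      α lam (p.FL2 z.fst) (p.ΨL2 z.snd) := by
  have := p.isProb
  obtain ⟨b, hb⟩ := h2.bound
  have hG : p.G z.fst = ∫ ω, p.g (p.FL2 z.fst ω) ∂p.P := by
    refine integral_congr_ae ?_
    filter_upwards [coeFn_toL2 hF] with ω hω
    rw [FL2, hω]
  unfold w bregman lyapunov
  rw [integral_bregman_eq h2.contDiff h2.lipschitz hb lam hF hΨ, hG]
  rfl

lemma Q_eq (p : Problem Ω nX nY nβ nf nθ) {β : Vec nβ} {θ : Vec nθ}
    (hF : MemLp (p.F β) 2 p.P) (hΨ : MemLp (fun ω => p.Ψ (p.X ω) θ) 2 p.P) :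
    p.Q β θ = 1 / 2 * ‖p.FL2 β - p.ΨL2 θ‖ ^ 2 := by
  rw [FL2, ΨL2, ← toL2_sub hF hΨ, norm_toL2_sq (memLp_fun_sub hF hΨ)]
  rfl

lemma isClosed_domain (h1 : p.A1) (R : ℝ) : IsClosed (p.domain R) := by
  refine IsClosed.inter (h1.compact.isClosed.preimage (WithLp.fstL 2 ℝ (Vec nβ) (Vec nθ)).continuous)
    (isClosed_le (WithLp.sndL 2 ℝ (Vec nβ) (Vec nθ)).continuous.norm continuous_const)

lemma norm_fst_le (z : Pair nβ nθ) : ‖z.fst‖ ≤ ‖z‖ := by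
  have h := WithLp.prod_norm_sq_eq_of_L2 z
  have := sq_nonneg ‖z.snd‖
  exact le_of_pow_le_pow_left₀ two_ne_zero (norm_nonneg _) (by linarith)

lemma norm_snd_le (z : Pair nβ nθ) : ‖z.snd‖ ≤ ‖z‖ := by
  have h := WithLp.prod_norm_sq_eq_of_L2 z
  have := sq_nonneg ‖z.fst‖
  exact le_of_pow_le_pow_left₀ two_ne_zero (norm_nonneg _) (by linarith)

lemma fst_mem_normalCone {R : ℝ} {z n : Pair nβ nθ} (hn : n ∈ normalCone (p.domain R) z) :
    n.fst ∈ normalCone p.B z.fst := by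
  refine ⟨hn.1.1, fun β hβ => ?_⟩
  have := hn.2 (WithLp.toLp 2 (β, z.snd)) ⟨hβ, hn.1.2⟩
  simpa [WithLp.prod_inner_apply] using this

lemma snd_mem_normalCone {R : ℝ} {z n : Pair nβ nθ} (hn : n ∈ normalCone (p.domain R) z) :
    n.snd ∈ normalCone (Metric.closedBall 0 R) z.snd := by
  refine ⟨by simpa using hn.1.2, fun θ hθ => ?_⟩
  have := hn.2 (WithLp.toLp 2 (z.fst, θ)) ⟨hn.1.1, by simpa using hθ⟩
  simpa [WithLp.prod_inner_apply] using this

/-- `w` is Lipschitz on the domain. -/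
lemma abs_w_sub_le {Lg Lf LΨ : ℝ} (h1 : p.A1) (h2 : p.A2 Lg) (h3 : p.A3 Lf) (h4 : p.A4 LΨ)
    (α lam R : ℝ) : ∃ C, ∀ z ∈ p.domain R, ∀ z₁ ∈ p.domain R,
      |p.w α lam z₁ - p.w α lam z| ≤ C * ‖z₁ - z‖ := by
  have := p.isProb
  obtain ⟨b, hb⟩ := h2.bound
  obtain ⟨a, ha, haL⟩ := h3.exists_isRandomGenJacobian h1
  obtain ⟨a', ha', haL'⟩ := h4.exists_isRandomGenJacobian
  have hFlip : ∀ β ∈ p.B, ∀ β₁ ∈ p.B, ‖p.FL2 β₁ - p.FL2 β‖ ≤ Lf * ‖β₁ - β‖ := by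
    intro β hβ β₁ hβ₁
    rw [p.FL2_eq (ha.memLp β hβ), p.FL2_eq (ha.memLp β₁ hβ₁), ← map_sub]
    exact (norm_condL2_le _ _).trans ((ha.norm_toL2_sub_le hβ hβ₁).trans (by gcongr))
  have hΨlip : ∀ θ θ₁, ‖p.ΨL2 θ₁ - p.ΨL2 θ‖ ≤ LΨ * ‖θ₁ - θ‖ := fun θ θ₁ =>
    (ha'.norm_toL2_sub_le (mem_univ θ) (mem_univ θ₁)).trans (by gcongr)
  obtain ⟨r₁, hr₁⟩ : ∃ r, ∀ β ∈ p.B, ‖p.FL2 β‖ ≤ r := by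
    have hc : ContinuousOn p.FL2 p.B := by
      refine (LipschitzOnWith.of_dist_le_mul (K := Lf.toNNReal) fun β hβ β₁ hβ₁ => ?_).continuousOn
      rw [dist_eq_norm, dist_eq_norm, Real.coe_toNNReal _ h3.pos.le]
      exact hFlip β₁ hβ₁ β hβ
    exact h1.compact.exists_bound_of_continuousOn hc
  have hr₂ : ∀ θ : Vec nθ, ‖θ‖ ≤ R → ‖p.ΨL2 θ‖ ≤ ‖p.ΨL2 0‖ + LΨ * R := by
    intro θ hθ
    have e1 := hΨlip 0 θ
    rw [sub_zero] at e1
    have e2 := norm_le_norm_add_norm_sub' (p.ΨL2 θ) (p.ΨL2 0)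
    have e3 : LΨ * ‖θ‖ ≤ LΨ * R := mul_le_mul_of_nonneg_left hθ h4.pos.le
    linarith
  obtain ⟨c, hc⟩ := abs_lyapunov_sub_le
    (abs_integral_sub_inner_gradL2_le (P := p.P) h2.contDiff h2.lipschitz hb)
    (norm_gradL2_sub_le h2.lipschitz hb) α lam (max r₁ (‖p.ΨL2 0‖ + LΨ * R))
  refine ⟨|c| * (Lf + LΨ), fun z hz z₁ hz₁ => ?_⟩
  rw [w_eq_lyapunov h2 α lam (p.memLp_F (ha.memLp _ hz.1)) (ha'.memLp _ (mem_univ _)),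
    w_eq_lyapunov h2 α lam (p.memLp_F (ha.memLp _ hz₁.1)) (ha'.memLp _ (mem_univ _))]
  refine (hc _ _ _ _ ((hr₁ _ hz.1).trans (le_max_left _ _)) ((hr₂ _ hz.2).trans (le_max_right _ _))
    ((hr₁ _ hz₁.1).trans (le_max_left _ _)) ((hr₂ _ hz₁.2).trans (le_max_right _ _))).trans ?_
  rw [mul_assoc]
  have e1 : ‖z₁.fst - z.fst‖ ≤ ‖z₁ - z‖ := norm_fst_le (z₁ - z)
  have e2 : ‖z₁.snd - z.snd‖ ≤ ‖z₁ - z‖ := norm_snd_le (z₁ - z)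
  have e3 := hFlip _ hz.1 _ hz₁.1
  have e4 := hΨlip z.snd z₁.snd
  have e5 : Lf * ‖z₁.fst - z.fst‖ ≤ Lf * ‖z₁ - z‖ := mul_le_mul_of_nonneg_left e1 h3.pos.le
  have e6 : LΨ * ‖z₁.snd - z.snd‖ ≤ LΨ * ‖z₁ - z‖ := mul_le_mul_of_nonneg_left e2 h4.pos.le
  calc c * _ ≤ |c| * (‖p.FL2 z₁.fst - p.FL2 z.fst‖ + ‖p.ΨL2 z₁.snd - p.ΨL2 z.snd‖) := by
        gcongr; exact le_abs_self c
    _ ≤ _ := by gcongr; linarith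

/-- A solution cannot stay on the sphere `‖θ‖ = R`: at a time of differentiability the normal
component in `θ` vanishes. -/
lemma A6.normal_snd_eq_zero {Rlow R : ℝ} (h6 : p.A6 Rlow) (hR : Rlow ≤ R) {γ : ℝ} (hγ : 0 < γ)
    {q : ℝ → Vec nθ} {t : ℝ} {d n : Vec nθ} {β : Vec nβ} (hβ : β ∈ p.B)
    (hq : HasDerivAt q (γ • d - n) t) (hqR : ∀ᶠ s in 𝓝 t, ‖q s‖ ≤ R)
    (hn : n ∈ normalCone (Metric.closedBall 0 R) (q t)) (hd : -d ∈ p.subdiffQθ β (q t)) :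
    n = 0 := by
  have hR0 : 0 < R := h6.pos.trans_le hR
  have hlt : ‖q t‖ < R := by
    by_contra hge
    rw [not_lt] at hge
    -- On the sphere the norm of the path is maximal at `t`, so the velocity is tangential. But ⟪q
    -- t, d⟫ < 0 by (A6) and ⟪q t, n⟫ ≥ 0, a contradiction.
    have hin : ⟪q t, γ • d - n⟫_ℝ = 0 := by
      refine inner_deriv_eq_zero_of_eventually_le hq ?_
      filter_upwards [hqR] with s hs
      rw [inner_sub_right, real_inner_self_eq_norm_sq]
      have h1 := real_inner_le_norm (q t) (q s)
      have h2 : ‖q t‖ * ‖q s‖ ≤ ‖q t‖ * ‖q t‖ := by gcongr; exact hs.trans hge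
      nlinarith
    have h1 := hn.2 0 (by simpa using hR0.le)
    have h2 := h6.inward β hβ (q t) (hR.trans hge) _ hd
    rw [inner_sub_right, inner_smul_right] at hin
    rw [zero_sub, inner_neg_right, real_inner_comm] at h1
    rw [inner_neg_right] at h2
    nlinarith
  by_contra hne
  have hpos : 0 < ‖n‖ := norm_pos_iff.2 hne
  -- Inside the ball there is room to move by `R - ‖q t‖` along `n`, which is incompatible with `n`
  -- being normal.
  have h1 := hn.2 (q t + ((R - ‖q t‖) / ‖n‖) • n) (by
    rw [mem_closedBall_zero_iff]
    refine (norm_add_le _ _).trans ?_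
    rw [norm_smul, Real.norm_eq_abs, abs_of_pos (div_pos (sub_pos.2 hlt) hpos),
      div_mul_cancel₀ _ hpos.ne']
    linarith)
  rw [add_sub_cancel_left, inner_smul_right, real_inner_self_eq_norm_sq] at h1
  have : 0 < (R - ‖q t‖) / ‖n‖ * ‖n‖ ^ 2 :=
    mul_pos (div_pos (sub_pos.2 hlt) hpos) (by positivity)
  linarith

end Problem

/-! ### Adjoints and expectations -/

section

variable {Ω : Type*} [mΩ : MeasurableSpace Ω] {P : Measure Ω} {m n : ℕ}

lemma toL2_congr_ae {E : Type*} [NormedAddCommGroup E] {u v : Ω → E} (hu : MemLp u 2 P)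
    (h : u =ᵐ[P] v) : toL2 P u = toL2 P v := by
  rw [toL2_eq hu, toL2_eq (hu.ae_eq h)]
  exact MemLp.toLp_congr _ _ h

/-- The linear map `J ↦ Jᵀ v`. -/
noncomputable def adjointApply (m : ℕ) {n : ℕ} (v : Vec n) : Jac m n →L[ℝ] Vec m :=
  LinearMap.toContinuousLinearMap
    { toFun := fun J => ContinuousLinearMap.adjoint J v
      map_add' := fun J J' => by simp
      map_smul' := fun c J => by simp }

lemma condExp_adjoint_ae_eq {m₀ : MeasurableSpace Ω} {J : Ω → Jac m n} (hJ : Integrable J P)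
    (v : Vec n) :
    P[fun ω => ContinuousLinearMap.adjoint (J ω) v|m₀]
      =ᵐ[P] fun ω => ContinuousLinearMap.adjoint (P[J|m₀] ω) v :=
  ((adjointApply m v).comp_condExp_comm hJ).symm

lemma integrable_apply {J : Ω → Jac m n} {x : Ω → Vec m} (hJ : MemLp J 2 P) (hx : MemLp x 2 P) :
    Integrable (fun ω => J ω (x ω)) P := by
  have h1 : Integrable (fun ω => ‖J ω‖ * ‖x ω‖) P := hJ.norm.integrable_mul hx.norm
  have hc : Continuous fun q : Jac m n × Vec m => q.1 q.2 := isBoundedBilinearMap_apply.continuous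
  exact h1.mono' (hc.comp_aestronglyMeasurable (hJ.1.prodMk hx.1))
    (Eventually.of_forall fun ω => (J ω).le_opNorm _)

/-- Turns L² pairings with the velocities u', v' into pairings with the expectations that make up Γ.
-/
lemma inner_toL2_adjoint {J : Ω → Jac m n} {x : Ω → Vec m} (hJ : MemLp J 2 P)
    (hx : MemLp x 2 P) (v : Vec n) :
    ⟪toL2 P x, toL2 P fun ω => ContinuousLinearMap.adjoint (J ω) v⟫_ℝ
      = ⟪∫ ω, J ω (x ω) ∂P, v⟫_ℝ := by
  rw [inner_toL2 hx (IsRandomGenJacobian.memLp_adjoint hJ v), real_inner_comm,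
    ← integral_inner (integrable_apply hJ hx)]
  refine integral_congr_ae (Eventually.of_forall fun ω => ?_)
  simp only
  rw [ContinuousLinearMap.adjoint_inner_right, real_inner_comm]

end

/-! ### Decrease of the Lyapunov function at a single time. -/

namespace Problem

variable {Ω : Type*} [mΩ : MeasurableSpace Ω] {nX nY nβ nf nθ : ℕ}
  {p : Problem Ω nX nY nβ nf nθ}

set_option maxHeartbeats 1000000 in
/-- The decrease of `w` at a state `z` along difference quotients of a path whose velocity at `z`
is `(β', γ d)`. -/
lemma lyapunov_decrease {Lg Lf LΨ M : ℝ}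
    (h1 : p.A1) (h2 : p.A2 Lg) (h3 : p.A3 Lf) (h4 : p.A4 LΨ) (h5 : p.A5 M)
    {α lam γ : ℝ} (hα : 0 < α) (hγ0 : 0 < γ)
    (hlam : 2 * LΨ ^ 2 * M * Lg < lam)
    (hγ : Lf ^ 2 * M * ((α + 1) * Lg + α * lam) ^ 2
      / (2 * α * (lam - 2 * LΨ ^ 2 * M * Lg)) < γ)
    {z : Pair nβ nθ} {zs : ℕ → Pair nβ nθ} (hz : z.fst ∈ p.B) (hzs : ∀ k, (zs k).fst ∈ p.B)
    {σ : Vec nX × Vec nY → Jac nf nβ} {σs : ℕ → Vec nX × Vec nY → Jac nf nβ}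
    (hσm : Measurable σ)
    (hσ : ∀ᵐ ω ∂p.P, σ (p.X ω, p.Y ω) ∈ p.subdiff_f (p.X ω) (p.Y ω) z.fst)
    (hσs : ∀ k, ∀ᵐ ω ∂p.P, σs k (p.X ω, p.Y ω) ∈ p.subdiff_f (p.X ω) (p.Y ω) (zs k).fst)
    (hσlim : ∀ᵐ ω ∂p.P,
      Tendsto (fun k => σs k (p.X ω, p.Y ω)) atTop (𝓝 (σ (p.X ω, p.Y ω))))
    {τ : Vec nX → Jac nf nθ} {τs : ℕ → Vec nX → Jac nf nθ}
    (hτ : τ ∈ p.selΨ z.snd) (hτs : ∀ k, τs k ∈ p.selΨ (zs k).snd)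
    (hτlim : ∀ᵐ ω ∂p.P, Tendsto (fun k => τs k (p.X ω)) atTop (𝓝 (τ (p.X ω))))
    {J : Ω → Jac nf nβ} (hJ : J = p.P[fun ω => σ (p.X ω, p.Y ω) | p.sigmaX])
    {β' ν : Vec nβ} {d θ' : Vec nθ}
    (hν : ν ∈ normalCone p.B z.fst) (hνβ : ⟪ν, β'⟫_ℝ = 0)
    (hβ' : β' = -∫ ω, J ω (gradient p.g (p.Ψ (p.X ω) z.snd)) ∂p.P - ν)
    (hd : d = ∫ ω, τ (p.X ω) (p.F z.fst ω - p.Ψ (p.X ω) z.snd) ∂p.P) (hθ' : θ' = γ • d)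
    {δ : ℕ → ℝ} (hδ : Tendsto δ atTop (𝓝 0)) (hδ0 : ∀ k, δ k ≠ 0)
    (hβlim : Tendsto (fun k => (δ k)⁻¹ • ((zs k).fst - z.fst)) atTop (𝓝 β'))
    (hθlim : Tendsto (fun k => (δ k)⁻¹ • ((zs k).snd - z.snd)) atTop (𝓝 θ'))
    (hzlim : Tendsto zs atTop (𝓝 z)) {W' : ℝ}
    (hW : Tendsto (fun k => (δ k)⁻¹ * (p.w α lam (zs k) - p.w α lam z)) atTop (𝓝 W')) :
    W' ≤ 0 ∧ (z ∉ p.Zstar → W' < 0) := by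
  have := p.isProb
  obtain ⟨b, hb⟩ := h2.bound
  obtain ⟨a, ha, haL⟩ := h3.exists_isRandomGenJacobian h1
  obtain ⟨a', ha', haL'⟩ := h4.exists_isRandomGenJacobian
  have hF : ∀ β ∈ p.B, MemLp (p.F β) 2 p.P := fun β hβ => p.memLp_F (ha.memLp β hβ)
  have hΨ : ∀ θ, MemLp (fun ω => p.Ψ (p.X ω) θ) 2 p.P := fun θ => ha'.memLp θ (mem_univ _)
  have hσL := ha.memLp_selection p.measurable_XY hz hσm hσ
  have hτL := ha'.memLp_selection p.measurable_X (mem_univ _) hτ.1 hτ.2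
  have hJL : MemLp J 2 p.P := hJ ▸ hσL.condExp one_le_two
  set u := p.FL2 z.fst with hu
  set v := p.ΨL2 z.snd with hv
  set u' : Lp (Vec nf) 2 p.P := toL2 p.P fun ω => ContinuousLinearMap.adjoint (J ω) β' with hu'
  set v' : Lp (Vec nf) 2 p.P := toL2 p.P fun ω => ContinuousLinearMap.adjoint (τ (p.X ω)) θ'
    with hv'
  have hfst : Tendsto (fun k => (zs k).fst) atTop (𝓝 z.fst) :=
    ((WithLp.fstL 2 ℝ (Vec nβ) (Vec nθ)).continuous.tendsto z).comp hzlim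
  have hsnd : Tendsto (fun k => (zs k).snd) atTop (𝓝 z.snd) :=
    ((WithLp.sndL 2 ℝ (Vec nβ) (Vec nθ)).continuous.tendsto z).comp hzlim
  have hu'eq : u' = condL2 p.P (Vec nf) p.sigmaX_le
      (toL2 p.P fun ω => ContinuousLinearMap.adjoint (σ (p.X ω, p.Y ω)) β') := by
    have hadj := IsRandomGenJacobian.memLp_adjoint hσL β'
    rw [← toL2_condExp p.sigmaX_le hadj, hu', hJ]
    exact (toL2_congr_ae (hadj.condExp one_le_two)
      (condExp_adjoint_ae_eq (hσL.integrable one_le_two) β')).symm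
  have hulim : Tendsto (fun k => (δ k)⁻¹ • (p.FL2 (zs k).fst - u)) atTop (𝓝 u') := by
    have h := ha.tendsto_slope p.measurable_XY hz hzs hfst hβlim hσm hσ hσs hσlim
    have h' := ((condL2 p.P (Vec nf) p.sigmaX_le).continuous.tendsto _).comp h
    rw [← hu'eq] at h'
    refine h'.congr fun k => ?_
    rw [hu, p.FL2_eq (ha.memLp _ (hzs k)), p.FL2_eq (ha.memLp _ hz), ← map_sub, ← map_smul]
    rfl
  have hvlim : Tendsto (fun k => (δ k)⁻¹ • (p.ΨL2 (zs k).snd - v)) atTop (𝓝 v') :=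
    ha'.tendsto_slope p.measurable_X (mem_univ _) (fun _ => mem_univ _) hsnd hθlim hτ.1 hτ.2
      (fun k => (hτs k).2) hτlim
  have hW2 : Tendsto (fun k => (δ k)⁻¹ *
      (lyapunov (fun u : Lp (Vec nf) 2 p.P => ∫ ω, p.g (u ω) ∂p.P) (gradL2 p.P p.g) α lam
        (p.FL2 (zs k).fst) (p.ΨL2 (zs k).snd)
      - lyapunov (fun u : Lp (Vec nf) 2 p.P => ∫ ω, p.g (u ω) ∂p.P) (gradL2 p.P p.g) α lam u v))
      atTop (𝓝 W') := by
    refine hW.congr fun k => ?_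
    rw [w_eq_lyapunov h2 α lam (hF _ (hzs k)) (hΨ _), w_eq_lyapunov h2 α lam (hF _ hz) (hΨ _)]
  have hAlip := norm_gradL2_sub_le (P := p.P) h2.lipschitz hb
  have main := le_of_tendsto_lyapunov
    (abs_integral_sub_inner_gradL2_le (P := p.P) h2.contDiff h2.lipschitz hb) hAlip hα.le
    hδ hδ0 hulim hvlim hW2
  -- the velocities
  have hgΨ : MemLp (fun ω => gradient p.g (p.Ψ (p.X ω) z.snd)) 2 p.P :=
    memLp_gradient h2.lipschitz hb (hΨ z.snd).1
  have hAv : gradL2 p.P p.g v = toL2 p.P fun ω => gradient p.g (p.Ψ (p.X ω) z.snd) := by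
    refine toL2_congr_ae (memLp_gradient h2.lipschitz hb (Lp.memLp v).1) ?_
    filter_upwards [coeFn_toL2 (hΨ z.snd)] with ω hω
    rw [hv, ΨL2, hω]
  have f1 : ⟪gradL2 p.P p.g v, u'⟫_ℝ = -‖β'‖ ^ 2 := by
    rw [hAv, hu', inner_toL2_adjoint hJL hgΨ]
    have : ∫ ω, J ω (gradient p.g (p.Ψ (p.X ω) z.snd)) ∂p.P = -β' - ν := by rw [hβ']; abel
    rw [this, inner_sub_left, inner_neg_left, hνβ, real_inner_self_eq_norm_sq, sub_zero]
  have f2 : ‖u'‖ ≤ Lf * ‖β'‖ := by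
    rw [hu'eq]
    exact (norm_condL2_le _ _).trans
      ((ha.norm_toL2_adjoint_le p.measurable_XY hz hσm hσ β').trans (by gcongr))
  have hθn : ‖θ'‖ = γ * ‖d‖ := by rw [hθ', norm_smul, Real.norm_eq_abs, abs_of_pos hγ0]
  have f3 : ‖v'‖ ≤ LΨ * (γ * ‖d‖) := by
    rw [← hθn]
    exact (ha'.norm_toL2_adjoint_le p.measurable_X (mem_univ _) hτ.1 hτ.2 θ').trans (by gcongr)
  have he : u - v = toL2 p.P fun ω => p.F z.fst ω - p.Ψ (p.X ω) z.snd :=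
    (toL2_sub (hF _ hz) (hΨ _)).symm
  have f4 : ⟪u - v, v'⟫_ℝ = γ * ‖d‖ ^ 2 := by
    rw [he, hv', inner_toL2_adjoint hτL (memLp_fun_sub (hF _ hz) (hΨ _)), ← hd, hθ',
      inner_smul_right, real_inner_self_eq_norm_sq]
  -- Apply Cauchy–Schwarz to `f4`, bound `v'` by `f3`, and divide by `γ * ‖d‖`.
  have f5 : ‖d‖ ≤ LΨ * ‖u - v‖ := by
    rcases (norm_nonneg d).eq_or_lt with h0 | hpos
    · rw [← h0]; exact mul_nonneg h4.pos.le (norm_nonneg _)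
    · have h := real_inner_le_norm (u - v) v'
      rw [f4] at h
      have h' : γ * ‖d‖ ^ 2 ≤ ‖u - v‖ * (LΨ * (γ * ‖d‖)) := h.trans (by gcongr)
      refine le_of_mul_le_mul_left (a := γ * ‖d‖) ?_ (by positivity)
      linarith
  have hQ := p.Q_eq (hF _ hz) (hΨ z.snd)
  rw [← hu, ← hv] at hQ
  have hQd : p.Q z.fst z.snd ≤ M * ‖d‖ ^ 2 := by
    refine (h5.growth _ hz _).trans ?_
    have hmem : -d ∈ p.subdiffQθ z.fst z.snd := ⟨τ, hτ, by rw [hd]⟩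
    have hle : Metric.infDist 0 (p.subdiffQθ z.fst z.snd) ≤ ‖d‖ := by
      simpa using Metric.infDist_le_dist_of_mem (x := (0 : Vec nθ)) hmem
    have := h5.pos
    have := Metric.infDist_nonneg (x := (0 : Vec nθ)) (s := p.subdiffQθ z.fst z.snd)
    gcongr
  -- `A2` does not require `Lg ≥ 0`; a negative Lipschitz constant forces `u = v`.
  have hL0 : Lg < 0 → ‖u - v‖ = 0 := by
    intro hneg
    have := (norm_nonneg _).trans (hAlip u v)
    nlinarith [norm_nonneg (u - v)]
  have hbound : W' ≤ -‖β'‖ ^ 2 + ((α + 1) * Lg + α * lam) * (Lf * ‖β'‖) * ‖u - v‖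
      + α * (Lg * (LΨ * (γ * ‖d‖)) * ‖u - v‖) - α * lam * (γ * ‖d‖ ^ 2) := by
    rw [inner_sub_right, f4] at main
    rcases lt_or_ge Lg 0 with hneg | hnn
    · have h0 := hL0 hneg
      have h00 : u - v = 0 := norm_eq_zero.1 h0
      have huv : u = v := sub_eq_zero.1 h00
      rw [h0] at main ⊢
      rw [h00, inner_zero_left, huv, f1] at main
      linarith
    · have hlam0 : 0 ≤ lam := by
        have := h5.pos
        have : 0 ≤ 2 * LΨ ^ 2 * M * Lg := by positivity
        linarith
      -- Writing (1 + α) A u - α A v = (1 + α)(A u - A v) + A v isolates ⟪A v, u'⟫ = -‖β'‖².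
      have g1 : ⟪gradL2 p.P p.g u, u'⟫_ℝ - ⟪gradL2 p.P p.g v, u'⟫_ℝ
          ≤ Lg * ‖u - v‖ * (Lf * ‖β'‖) := by
        rw [← inner_sub_left]
        refine (real_inner_le_norm _ _).trans ?_
        have := hAlip u v
        gcongr
      have g2 : ⟪u - v, u'⟫_ℝ ≤ ‖u - v‖ * (Lf * ‖β'‖) :=
        (real_inner_le_norm _ _).trans (by gcongr)
      have g3 : Lg * ‖v'‖ * ‖u - v‖ ≤ Lg * (LΨ * (γ * ‖d‖)) * ‖u - v‖ := by gcongr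
      have g1' := mul_le_mul_of_nonneg_left g1 (by linarith : 0 ≤ 1 + α)
      have g2' := mul_le_mul_of_nonneg_left g2 (mul_nonneg hα.le hlam0)
      have g3' := mul_le_mul_of_nonneg_left g3 hα.le
      rw [f1] at main g1'
      linarith
  obtain ⟨r1, r2⟩ := dissipation_le h5.pos h4.pos hα hγ0 (norm_nonneg (u - v)) (norm_nonneg β')
    (norm_nonneg d) hL0 hlam hγ (by linarith) f5 hbound
  refine ⟨r1, fun hzn => r2 fun ⟨hb0, hd0⟩ => hzn ?_⟩
  have hQ0 : p.Q z.fst z.snd = 0 := by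
    rw [hd0] at hQd
    have : 0 ≤ p.Q z.fst z.snd := by rw [hQ]; positivity
    linarith
  refine ⟨⟨hz, ?_⟩, hQ0⟩
  have huv : u = v := by
    rw [hQ] at hQ0
    have : ‖u - v‖ ^ 2 = 0 := by linarith
    exact sub_eq_zero.1 (norm_eq_zero.1 (pow_eq_zero_iff two_ne_zero |>.1 this))
  have hFΨ : p.F z.fst =ᵐ[p.P] fun ω => p.Ψ (p.X ω) z.snd := by
    filter_upwards [coeFn_toL2 (hF _ hz), coeFn_toL2 (hΨ z.snd)] with ω e1 e2
    rw [← e1, ← e2]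
    exact congrArg (fun x : Lp (Vec nf) 2 p.P => x ω) huv
  -- As F = Ψ almost surely, the same `J` yields an element of ∂G, and the same `ν` cancels it
  -- because β' = 0.
  refine ⟨_, ⟨J, ⟨σ, hσm, hσ, hJ⟩, rfl⟩, ν, hν, ?_⟩
  have : ∫ ω, J ω (gradient p.g (p.F z.fst ω)) ∂p.P
      = ∫ ω, J ω (gradient p.g (p.Ψ (p.X ω) z.snd)) ∂p.P := by
    refine integral_congr_ae ?_
    filter_upwards [hFΨ] with ω hω
    rw [hω]
  simp only
  rw [this]
  rw [norm_eq_zero.1 hb0] at hβ'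
  have h0 : ∀ x y : Vec nβ, 0 = -x - y → x + y = 0 := fun x y h => by
    rw [← neg_eq_zero, neg_add, ← sub_eq_add_neg, ← h]
  exact h0 _ _ hβ'

end Problem

lemma tendsto_inv_smul_of_hasDerivAt {E : Type*} [NormedAddCommGroup E] [NormedSpace ℝ E]
    {q : ℝ → E} {q' : E} {t : ℝ} (h : HasDerivAt q q' t) {ts : ℕ → ℝ}
    (hts : Tendsto ts atTop (𝓝 t)) (hne : ∀ k, ts k ≠ t) :
    Tendsto (fun k => (ts k - t)⁻¹ • (q (ts k) - q t)) atTop (𝓝 q') := by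
  have h1 := hasDerivAt_iff_tendsto_slope.1 h
  exact h1.comp (tendsto_nhdsWithin_iff.2 ⟨hts, Eventually.of_forall hne⟩)

end CondStochOpt

/-! ### Descent along a solution. -/

theorem mainTheorem3 {Ω : Type*} [MeasurableSpace Ω] {nX nY nβ nf nθ : ℕ}
    (p : CondStochOpt.Problem Ω nX nY nβ nf nθ)
    (Lg' Lf LΨ M Rlow : ℝ)
    (h1 : p.A1) (h2 : p.A2 Lg') (h3 : p.A3 Lf) (h4 : p.A4 LΨ) (h5 : p.A5 M) (h6 : p.A6 Rlow)
    (R : ℝ) (hR : Rlow ≤ R)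
    (α lam γ : ℝ) (hα : 0 < α) (hlam0 : 0 ≤ lam) (hγ0 : 0 < γ)
    (hlam : 2 * LΨ ^ 2 * M * Lg' < lam)
    (hγ : Lf ^ 2 * M * ((α + 1) * Lg' + α * lam) ^ 2
      / (2 * α * (lam - 2 * LΨ ^ 2 * M * Lg')) < γ)
    (Z : ℝ → CondStochOpt.Pair nβ nθ) (hZ : p.IsSolution γ R Z) :
    (∃ W' : ℝ → ℝ, CondStochOpt.HasWeakDeriv (fun t => p.w α lam (Z t)) W') ∧
    ∀ W' : ℝ → ℝ, CondStochOpt.HasWeakDeriv (fun t => p.w α lam (Z t)) W' →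
      ∀ᵐ t ∂(MeasureTheory.volume.restrict (Set.Ici (0 : ℝ))),
        W' t ≤ 0 ∧ (Z t ∉ p.Zstar → W' t < 0) := by
  have := p.isProb
  obtain ⟨Z', hZZ', hincl⟩ := hZ
  have hdom : ∀ t, 0 ≤ t → Z t ∈ p.domain R := by
    refine fun t ht => CondStochOpt.forall_mem_of_ae_mem
      (CondStochOpt.Problem.isClosed_domain h1 R) hZZ'.continuousOn ?_ ht
    filter_upwards [hincl] with s hs
    obtain ⟨_, -, n, hn, -⟩ := hs
    exact hn.1
  refine ⟨?_, fun W' hW' => ?_⟩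
  · obtain ⟨C, hC⟩ := CondStochOpt.Problem.abs_w_sub_le h1 h2 h3 h4 α lam R
    exact ⟨_, hZZ'.exists_of_abs_sub_le (C := C) fun s t hs ht =>
      hC _ (hdom s hs) _ (hdom t ht)⟩
  obtain ⟨a, ha, -⟩ := h3.exists_isRandomGenJacobian h1
  obtain ⟨a', ha', -⟩ := h4.exists_isRandomGenJacobian
  -- The times at which the inclusion holds; selections are chosen separately at each of them, with
  -- no measurability in `t`.
  set T : Set ℝ := {t | 0 ≤ t ∧ Z' t ∈ p.directions γ (Z t)
    - CondStochOpt.normalCone (p.domain R) (Z t)} with hT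
  have hsel : ∀ t ∈ T, ∃ (σ : CondStochOpt.Vec nX × CondStochOpt.Vec nY → CondStochOpt.Jac nf nβ)
      (τ : CondStochOpt.Vec nX → CondStochOpt.Jac nf nθ) (n : CondStochOpt.Pair nβ nθ),
      Measurable σ ∧
      (∀ᵐ ω ∂p.P, σ (p.X ω, p.Y ω) ∈ p.subdiff_f (p.X ω) (p.Y ω) (Z t).fst) ∧
      τ ∈ p.selΨ (Z t).snd ∧ n ∈ CondStochOpt.normalCone (p.domain R) (Z t) ∧
      (Z' t).fst = -∫ ω, (p.P[fun ω => σ (p.X ω, p.Y ω) | p.sigmaX]) ω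
        (gradient p.g (p.Ψ (p.X ω) (Z t).snd)) ∂p.P - n.fst ∧
      (Z' t).snd = γ • ∫ ω, τ (p.X ω) (p.F (Z t).fst ω - p.Ψ (p.X ω) (Z t).snd) ∂p.P
        - n.snd := by
    rintro t ⟨-, _, ⟨_, ⟨σ, hσm, hσ, rfl⟩, τ, hτ, rfl⟩, n, hn, hd⟩
    refine ⟨σ, τ, n, hσm, hσ, hτ, hn, ?_, ?_⟩
    · rw [← hd]; rfl
    · rw [← hd]; rfl
  choose! σ τ n hσm hσ hτ hn hfst hsnd using hsel
  have hTdom : ∀ t ∈ T, Z t ∈ p.domain R := fun t ht => hdom t ht.1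
  obtain ⟨N, hN, hseq⟩ := CondStochOpt.exists_seq_tendsto_selections (P := p.P)
    p.measurable_XY p.measurable_X T σ τ
    (fun t ht => (memLp_map_measure_iff (hσm t ht).aestronglyMeasurable
      p.measurable_XY.aemeasurable).2
      (ha.memLp_selection p.measurable_XY (hTdom t ht).1 (hσm t ht) (hσ t ht)))
    (fun t ht => (memLp_map_measure_iff (hτ t ht).1.aestronglyMeasurable
      p.measurable_X.aemeasurable).2
      (ha'.memLp_selection p.measurable_X (Set.mem_univ _) (hτ t ht).1 (hτ t ht).2))
  have hNae : ∀ᵐ t ∂(volume.restrict (Ici (0 : ℝ))), t ∉ N :=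
    ae_restrict_of_ae (hN.ae_notMem volume)
  -- At such `t` both Z and W are differentiable, so quotients along the single sequence of times
  -- found below compute `Z' t` and `W' t`.
  filter_upwards [hZZ'.ae_hasDerivAt, hW'.ae_hasDerivAt, hincl, hNae,
    ae_restrict_mem measurableSet_Ici] with t hZt hWt hit htN ht0
  have htT : t ∈ T := ⟨ht0, hit⟩
  obtain ⟨ts, htsT, htslim, hσlim, hτlim⟩ := hseq t htT htN
  have hne : ∀ k, ts k ≠ t := fun k => (htsT k).2
  have hpos : ∀ᶠ s in 𝓝 t, 0 ≤ s := by
    filter_upwards [lt_mem_nhds hZt.1] with s hs using hs.le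
  have hβd : HasDerivAt (fun s => (Z s).fst) (Z' t).fst t :=
    (WithLp.fstL 2 ℝ (CondStochOpt.Vec nβ) (CondStochOpt.Vec nθ)).hasFDerivAt.comp_hasDerivAt t hZt.2
  have hθd : HasDerivAt (fun s => (Z s).snd) (Z' t).snd t :=
    (WithLp.sndL 2 ℝ (CondStochOpt.Vec nβ) (CondStochOpt.Vec nθ)).hasFDerivAt.comp_hasDerivAt t hZt.2
  have hnβ := CondStochOpt.Problem.fst_mem_normalCone (hn t htT)
  have hn0 : (n t).snd = 0 := by
    have hθd' := hθd
    rw [hsnd t htT] at hθd'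
    refine h6.normal_snd_eq_zero (q := fun s => (Z s).snd) (β := (Z t).fst) hR hγ0
      (hTdom t htT).1 hθd' ?_ (CondStochOpt.Problem.snd_mem_normalCone (hn t htT))
      ⟨τ t, hτ t htT, rfl⟩
    filter_upwards [hpos] with s hs using (hdom s hs).2
  refine CondStochOpt.Problem.lyapunov_decrease h1 h2 h3 h4 h5 hα hγ0 hlam hγ
    (zs := fun k => Z (ts k)) (δ := fun k => ts k - t)
    (hTdom t htT).1 (fun k => (hTdom _ (htsT k).1).1) (hσm t htT) (hσ t htT)
    (fun k => hσ _ (htsT k).1) hσlim (hτ t htT) (fun k => hτ _ (htsT k).1) hτlim rfl hnβ ?_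
    (hfst t htT) rfl (θ' := (Z' t).snd) ?_ ?_ (fun k => sub_ne_zero.2 (hne k))
    (CondStochOpt.tendsto_inv_smul_of_hasDerivAt hβd htslim hne)
    (CondStochOpt.tendsto_inv_smul_of_hasDerivAt hθd htslim hne)
    (hZt.2.continuousAt.tendsto.comp htslim) ?_
  · refine CondStochOpt.inner_deriv_eq_zero_of_eventually_le hβd ?_
    filter_upwards [hpos] with s hs using hnβ.2 _ (hdom s hs).1
  · rw [hsnd t htT, hn0, sub_zero]
  · simpa using htslim.sub_const t
  · simpa only [smul_eq_mul] using CondStochOpt.tendsto_inv_smul_of_hasDerivAt hWt.2 htslim hne
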